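/- Let $\theta\in(0,\pi)$ with $\theta\ne\pi/4,\pi/2,3\pi/4$, and put $c=\cos\theta$, $s=\sin\theta$. On $\ell^2(\mathbb Z)\otimes\mathbb C^2$, with the standard orthonormal bases $\{|x\rangle : x\in\mathbb Z\}$ and $\{|0\rangle,|1\rangle\}$, consider the unitary operators $$U_1=\sum_{x\in\mathbb Z}\Bigl\{|x-1\rangle\langle x|\otimes\tfrac c2\bigl(|0\rangle\langle0|-|1\rangle\langle0|+|0\rangle\langle1|-|1\rangle\langle1|\bigr)+|x\rangle\langle x|\otimes s\bigl(|0\rangle\langle1|+|1\rangle\langle0|\bigr)+|x+1\rangle\langle x|\otimes\tfrac c2\bigl(|0\rangle\langle0|+|1\rangle\langle0|-|0\rangle\langle1|-|1\rangle\langle1|\bigr)\Bigr\},$$ $$U_2=\sum_{x\in\mathbb Z}\Bigl\{|x-1\rangle\langle x|\otimes s|0\rangle\langle1|+|x\rangle\langle x|\otimes c\bigl(|0\rangle\langle0|-|1\rangle\langle1|\bigr)+|x+1\rangle\langle x|\otimes s|1\rangle\langle0|\Bigr\}.$$ Let $\alpha,\beta\in\mathbb C$ with $|\alpha|^2+|\beta|^2=1$,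 let $\Psi_0=|0\rangle\otimes(\alpha|0\rangle+\beta|1\rangle)$ and $\Psi_{t+1}=U_2U_1\Psi_t$ for $t=0,1,2,\dots$, and let $X_t$ be a $\mathbb Z$-valued random variable with $\mathbb P(X_t=x)=\|(\langle x|\otimes I)\Psi_t\|^2$. Put $$D(x)=1-4c^2s^2+c^2s^2x^2,\qquad \mathcal D=\bigl(\sqrt{1-2|c|s},\sqrt{1+2|c|s}\bigr),$$ $$W_+(x)=-2(1-2|c|s)+(1-|c|s)x^2+x\sqrt{D(x)},\qquad W_-(x)=2(1+2|c|s)-(1+|c|s)x^2-x\sqrt{D(x)},$$ $$f(x)=\frac{\bigl(x+2\sqrt{D(x)}\bigr)^2}{2\pi(4-x^2)\sqrt{D(x)}\sqrt{W_+(x)}\sqrt{W_-(x)}},$$ $$\nu_\pm(\alpha,\beta;x)=\frac1{2c^2-1}\Bigl\{\bigl(c^2x\mp\sqrt{D(x)}\bigr)\bigl(|\alpha|^2-|\beta|^2\bigr)-\bigl(s^2x\mp\sqrt{D(x)}\bigr)\bigl(\alpha\overline\beta+\overline\alpha\beta\bigr)\Bigr\},$$ $$\chi(x)=f(x)\bigl(1-\nu_+(\alpha,\beta;x)\bigr)I_{\mathcal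 D}(x)+f(-x)\bigl(1-\nu_-(\alpha,\beta;x)\bigr)I_{\mathcal D}(-x),$$ where $I_{\mathcal D}$ is the indicator function of $\mathcal D$ and each summand of $\chi$ is read as $0$ where its indicator vanishes. Then $\chi$ is a probability density on $\mathbb R$ that vanishes outside $(-\mathcal D)\cup\mathcal D$, and for every real $x$ $$\lim_{t\to\infty}\mathbb P\Bigl(\frac{X_t}t\le x\Bigr)=\int_{-\infty}^x\chi(y)\,dy;$$ that is, $X_t/t$ converges weakly to the absolutely continuous law with density $\chi$. In particular the distribution has a gap around the origin: $\sqrt{1-2|c|s}>0$ and $\mathbb P\bigl(|X_t/t|\le\sqrt{1-2|c|s}\bigr)\to0$ as $t\to\infty$. -/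

import Mathlib

open MeasureTheory Filter Topology

noncomputable section

namespace GapWalk

/-- The coin space, with orthonormal basis `|0⟩ = (1,0)`, `|1⟩ = (0,1)`. -/
abbrev Coin : Type := EuclideanSpace ℂ (Fin 2)

/-- The Hilbert space of the walker: the tensor product of the position space `ℓ²(ℤ)` and the coin
space, realised as the space of square-summable functions from `ℤ` to the coin space. The vector
`|x⟩ ⊗ φ` is the function supported at `x` with value `φ`. -/
abbrev State : Type := lp (fun _ : ℤ => Coin) 2

theorem memlp_shift (d : ℤ) (M : Matrix (Fin 2) (Fin 2) ℂ) (Ψ : State) :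
    Memℓp (fun x : ℤ => Matrix.toEuclideanCLM (𝕜 := ℂ) M (Ψ (x - d))) 2 := by
  have h2 : (0 : ℝ) < (2 : ENNReal).toReal := by norm_num
  refine memℓp_gen ?_
  have h1 : Summable fun x : ℤ => ‖Ψ (x - d)‖ ^ (2 : ENNReal).toReal :=
    ((Equiv.subRight d).summable_iff (f := fun x : ℤ => ‖Ψ x‖ ^ (2 : ENNReal).toReal)).2
      ((lp.memℓp Ψ).summable h2)
  refine Summable.of_nonneg_of_le (fun x => by positivity) (fun x => ?_)
    (h1.mul_left (‖Matrix.toEuclideanCLM (𝕜 := ℂ) M‖ ^ (2 : ENNReal).toReal))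
  rw [← Real.mul_rpow (norm_nonneg _) (norm_nonneg _)]
  exact Real.rpow_le_rpow (norm_nonneg _) (ContinuousLinearMap.le_opNorm _ _) h2.le

/-- The operator `∑ₓ |x + d⟩⟨x| ⊗ M` on the space of the walker. -/
def shift (d : ℤ) (M : Matrix (Fin 2) (Fin 2) ℂ) : State →ₗ[ℂ] State where
  toFun Ψ := ⟨fun x : ℤ => Matrix.toEuclideanCLM (𝕜 := ℂ) M (Ψ (x - d)), memlp_shift d M Ψ⟩
  map_add' Ψ Φ := by
    ext x : 2
    exact map_add (Matrix.toEuclideanCLM (𝕜 := ℂ) M) (Ψ (x - d)) (Φ (x - d))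
  map_smul' a Ψ := by
    ext x : 2
    exact map_smul (Matrix.toEuclideanCLM (𝕜 := ℂ) M) a (Ψ (x - d))

/-- The first operation. The matrix of `|i⟩⟨j|` has its entry in row `i` and column `j`. -/
def U₁ (θ : ℝ) : State →ₗ[ℂ] State :=
  shift (-1) (((Real.cos θ / 2 : ℝ) : ℂ) • !![1, 1; -1, -1])
    + shift 0 (((Real.sin θ : ℝ) : ℂ) • !![0, 1; 1, 0])
    + shift 1 (((Real.cos θ / 2 : ℝ) : ℂ) • !![1, -1; 1, -1])

/-- The second operation. -/
def U₂ (θ : ℝ) : State →ₗ[ℂ] State :=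
  shift (-1) (((Real.sin θ : ℝ) : ℂ) • !![0, 1; 0, 0])
    + shift 0 (((Real.cos θ : ℝ) : ℂ) • !![1, 0; 0, -1])
    + shift 1 (((Real.sin θ : ℝ) : ℂ) • !![0, 0; 1, 0])

/-- The state at time `t` of the walk started in `|0⟩ ⊗ (α|0⟩ + β|1⟩)`. -/
def walk (θ : ℝ) (α β : ℂ) : ℕ → State
  | 0 => lp.single 2 (0 : ℤ) (!₂[α, β] : Coin)
  | t + 1 => U₂ θ (U₁ θ (walk θ α β t))

/-- The law on `ℤ` of the position `X_t`: the mass at `x` is the squared norm of the component of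
the state at the position `x`. -/
def positionLaw (θ : ℝ) (α β : ℂ) (t : ℕ) : Measure ℤ :=
  Measure.sum fun x : ℤ => ENNReal.ofReal (‖walk θ α β t x‖ ^ 2) • Measure.dirac x

/-- `|c| s`, where `c = cos θ` and `s = sin θ`. -/
def cs (θ : ℝ) : ℝ := |Real.cos θ| * Real.sin θ

/-- `D(x) = 1 - 4c²s² + c²s²x²`. -/
def D (θ x : ℝ) : ℝ :=
  1 - 4 * Real.cos θ ^ 2 * Real.sin θ ^ 2 + Real.cos θ ^ 2 * Real.sin θ ^ 2 * x ^ 2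

def Wplus (θ x : ℝ) : ℝ :=
  -2 * (1 - 2 * cs θ) + (1 - cs θ) * x ^ 2 + x * √(D θ x)

def Wminus (θ x : ℝ) : ℝ :=
  2 * (1 + 2 * cs θ) - (1 + cs θ) * x ^ 2 - x * √(D θ x)

def f (θ x : ℝ) : ℝ :=
  (x + 2 * √(D θ x)) ^ 2 /
    (2 * Real.pi * (4 - x ^ 2) * √(D θ x) * √(Wplus θ x) * √(Wminus θ x))

/-- `ν₊` for `ε = 1` and `ν₋` for `ε = -1`. The number `α β̄ + ᾱ β` is real. -/
def nu (ε θ : ℝ) (α β : ℂ) (x : ℝ) : ℝ :=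
  1 / (2 * Real.cos θ ^ 2 - 1) *
    ((Real.cos θ ^ 2 * x - ε * √(D θ x)) * (‖α‖ ^ 2 - ‖β‖ ^ 2)
      - (Real.sin θ ^ 2 * x - ε * √(D θ x)) * (α * star β + star α * β).re)

/-- The inner and outer edges of the distribution. -/
def innerEdge (θ : ℝ) : ℝ := √(1 - 2 * cs θ)

def outerEdge (θ : ℝ) : ℝ := √(1 + 2 * cs θ)

/-- The limit density. -/
def density (θ : ℝ) (α β : ℂ) (x : ℝ) : ℝ :=
  f θ x * (1 - nu 1 θ α β x) * (Set.Ioo (innerEdge θ) (outerEdge θ)).indicator 1 x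
    + f θ (-x) * (1 - nu (-1) θ α β x) * (Set.Ioo (innerEdge θ) (outerEdge θ)).indicator 1 (-x)

/-- The limit law, absolutely continuous with respect to Lebesgue measure. -/
def limitLaw (θ : ℝ) (α β : ℂ) : Measure ℝ :=
  volume.withDensity fun x => ENNReal.ofReal (density θ α β x)

end GapWalk

end

open MeasureTheory Filter Topology

noncomputable section

namespace GapWalk

open Complex (I)

/-! Write a = cos θ sin θ, b = |a| < 1/2 and w(k) = 1 - a cos k. In Fourier space one time step is
multiplication by a 2×2 matrix, the product of two Hermitian reflections, hence of the form cos φ(k)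
+ i sin φ(k) n(k)·σ with n(k) a unit vector (`symbol_mul`). Its eigenvalues are exp(±iφ(k)), and φ'
is `speed` (`hasDerivAt_band`).

By Parseval, the characteristic function of X_t/t at ξ is the mean over k of the inner product of
the amplitudes at k and at k - ξ/t (`charFun_map_positionLaw`). The eigenvalue ratios to the power t
tend to exp(∓iξφ'(k)) (`tendsto_band_pow`), and the cross terms vanish because the two eigenspaces
are orthogonal. Dominated convergence then yields the limit law: velocity ∓φ'(k) with weight (1 ±
⟨n(k)·σ⟩)/2, for k uniform on the circle.

It remains to recognise the density. The part of ⟨n(k)·σ⟩ odd in k cancels, since the speed is even;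
the even part is `bias`, which is ν₊ in the variable k (`nu_speed`). On (0,π) the speed is injective
with image 𝒟 (`injOn_speed`, `image_speed`), and f is the reciprocal of 2π times the absolute
Jacobian (`abs_deriv_mul_f_speed`). Lévy's continuity theorem and the portmanteau theorem finish the
proof; the gap is the absence of group velocities below the inner edge. -/

/-! ### Dispersion relation and group velocity. -/

/-- The product `cos θ sin θ`, which governs the dispersion relation. -/
def coupling (θ : ℝ) : ℝ := Real.cos θ * Real.sin θ

/-- The affine image `1 - cos θ sin θ cos k` of `cos k`. -/
def offset (θ k : ℝ) : ℝ := 1 - coupling θ * Real.cos k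

/-- The positive factor `√((1 - cos θ sin θ cos k)² - (cos θ sin θ)²)` of the sine of the
quasi-energy. -/
def gapRoot (θ k : ℝ) : ℝ := √(offset θ k ^ 2 - coupling θ ^ 2)

/-- The modulus of the group velocity at the wave number `k`. -/
def speed (θ k : ℝ) : ℝ := (2 * offset θ k - 1) / gapRoot θ k

/-- The even part in `k` of the expectation of the Bloch axis in the initial state. -/
def bias (θ : ℝ) (α β : ℂ) (k : ℝ) : ℝ :=
  ((offset θ k - Real.cos θ ^ 2) * (‖α‖ ^ 2 - ‖β‖ ^ 2)
    + (offset θ k - Real.sin θ ^ 2) * (α * star β + star α * β).re) / gapRoot θ k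

/-- This is sin² 2θ = 1 - cos² 2θ. It links the condition cos 2θ ≠ 0 to b < 1/2. -/
theorem four_mul_coupling_sq (θ : ℝ) :
    4 * coupling θ ^ 2 = 1 - (2 * Real.cos θ ^ 2 - 1) ^ 2 := by
  have := Real.sin_sq θ
  rw [coupling, mul_pow, this]; ring

theorem two_mul_cos_sq_sub_one_ne_zero {θ : ℝ} (hθ : θ ∈ Set.Ioo 0 Real.pi)
    (hθ₁ : θ ≠ Real.pi / 4) (hθ₃ : θ ≠ 3 * Real.pi / 4) : 2 * Real.cos θ ^ 2 - 1 ≠ 0 := by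
  rw [← Real.cos_two_mul]
  intro h
  obtain ⟨n, hn⟩ := Real.cos_eq_zero_iff.1 h
  have hpi := Real.pi_pos
  have h1 : (-1 : ℝ) < n := by
    by_contra! hc
    nlinarith [hθ.1]
  have h2 : (n : ℝ) < 2 := by
    by_contra! hc
    nlinarith [hθ.2]
  have h1' : -1 < n := by exact_mod_cast h1
  have h2' : n < 2 := by exact_mod_cast h2
  obtain rfl | rfl : n = 0 ∨ n = 1 := by omega
  · apply hθ₁; push_cast at hn; linarith
  · apply hθ₃; push_cast at hn; linarith

theorem abs_coupling_lt {θ : ℝ} (h : 2 * Real.cos θ ^ 2 - 1 ≠ 0) : |coupling θ| < 1 / 2 := by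
  have h0 : 0 < (2 * Real.cos θ ^ 2 - 1) ^ 2 := by positivity
  have := four_mul_coupling_sq θ
  rw [abs_lt]
  constructor <;> nlinarith

theorem coupling_ne_zero {θ : ℝ} (hθ : θ ∈ Set.Ioo 0 Real.pi) (hθ₂ : θ ≠ Real.pi / 2) :
    coupling θ ≠ 0 := by
  have hs := Real.sin_pos_of_mem_Ioo hθ
  refine mul_ne_zero (fun h => hθ₂ ?_) hs.ne'
  refine Real.injOn_cos ⟨hθ.1.le, hθ.2.le⟩ ⟨by positivity, by linarith [Real.pi_pos]⟩ ?_
  rw [h, Real.cos_pi_div_two]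

theorem cs_eq {θ : ℝ} (hθ : θ ∈ Set.Ioo 0 Real.pi) : cs θ = |coupling θ| := by
  rw [cs, coupling, abs_mul, abs_of_pos (Real.sin_pos_of_mem_Ioo hθ)]

theorem D_eq (θ x : ℝ) : D θ x = 1 - 4 * coupling θ ^ 2 + coupling θ ^ 2 * x ^ 2 := by
  rw [D, coupling]; ring

theorem coupling_mul_cos_mem (θ k : ℝ) :
    coupling θ * Real.cos k ∈ Set.Icc (-|coupling θ|) |coupling θ| := by
  rw [Set.mem_Icc, ← abs_le, abs_mul]
  exact mul_le_of_le_one_right (abs_nonneg _) (Real.abs_cos_le_one k)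

theorem offset_mem (θ k : ℝ) :
    offset θ k ∈ Set.Icc (1 - |coupling θ|) (1 + |coupling θ|) := by
  have h := coupling_mul_cos_mem θ k
  rw [offset]; constructor <;> linarith [h.1, h.2]

theorem offset_mem_Ioo {θ k : ℝ} (h0 : coupling θ ≠ 0) (hk : k ∈ Set.Ioo 0 Real.pi) :
    offset θ k ∈ Set.Ioo (1 - |coupling θ|) (1 + |coupling θ|) := by
  have h : |coupling θ * Real.cos k| < |coupling θ| := by
    rw [abs_mul]
    refine mul_lt_of_lt_one_right (abs_pos.2 h0) ?_
    rw [abs_lt]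
    have hs := Real.sin_pos_of_mem_Ioo hk
    constructor <;> nlinarith [Real.sin_sq_add_cos_sq k]
  rw [abs_lt] at h
  rw [offset]; constructor <;> linarith [h.1, h.2]

theorem hasDerivAt_offset (θ k : ℝ) :
    HasDerivAt (offset θ) (coupling θ * Real.sin k) k := by
  have h : HasDerivAt (offset θ) _ k :=
    ((Real.hasDerivAt_cos k).const_mul (coupling θ)).const_sub 1
  exact h.congr_deriv (by ring)

theorem continuous_offset (θ : ℝ) : Continuous (offset θ) := by
  unfold offset; fun_prop

/-- Since b < 1/2, w ≥ 1 - b > 1/2 > b. -/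
theorem gapRoot_arg_pos {θ : ℝ} (ha : |coupling θ| < 1 / 2)
    (k : ℝ) : 0 < offset θ k ^ 2 - coupling θ ^ 2 := by
  have h := offset_mem θ k
  have h0 := abs_nonneg (coupling θ)
  rw [← sq_abs (coupling θ)]
  nlinarith [h.1, h.2]

theorem gapRoot_pos {θ : ℝ} (ha : |coupling θ| < 1 / 2)
    (k : ℝ) : 0 < gapRoot θ k := Real.sqrt_pos.2 (gapRoot_arg_pos ha k)

theorem gapRoot_sq {θ : ℝ} (ha : |coupling θ| < 1 / 2)
    (k : ℝ) : gapRoot θ k ^ 2 = offset θ k ^ 2 - coupling θ ^ 2 :=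
  Real.sq_sqrt (gapRoot_arg_pos ha k).le

/-- At the least possible value w = 1 - b the expression is (1 - 2b)(1 + b). The next lemma
similarly rests on (1 - 2b)(3 + 2b). -/
theorem offset_sub_pos {θ : ℝ} (ha : |coupling θ| < 1 / 2)
    (k : ℝ) : 0 < offset θ k - 2 * coupling θ ^ 2 := by
  have h := offset_mem θ k
  have h0 := abs_nonneg (coupling θ)
  rw [← sq_abs (coupling θ)]
  nlinarith [h.1, h.2]

theorem four_mul_offset_sub_pos {θ : ℝ} (ha : |coupling θ| < 1 / 2)
    (k : ℝ) : 0 < 4 * offset θ k - 1 - 4 * coupling θ ^ 2 := by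
  have h := offset_mem θ k
  have h0 := abs_nonneg (coupling θ)
  rw [← sq_abs (coupling θ)]
  nlinarith [h.1, h.2]

theorem speed_pos {θ : ℝ} (ha : |coupling θ| < 1 / 2) (k : ℝ) : 0 < speed θ k :=
  div_pos (by linarith [(offset_mem θ k).1]) (gapRoot_pos ha k)

theorem speed_sq {θ : ℝ} (ha : |coupling θ| < 1 / 2) (k : ℝ) :
    speed θ k ^ 2 * (offset θ k ^ 2 - coupling θ ^ 2) = (2 * offset θ k - 1) ^ 2 := by
  have := (gapRoot_pos ha k).ne'
  rw [← gapRoot_sq ha, speed]; field_simp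

/-- Along the dispersion relation D becomes a perfect square, so all square roots of D turn rational
in w and `gapRoot`. -/
theorem sqrt_D_speed {θ : ℝ} (ha : |coupling θ| < 1 / 2) (k : ℝ) :
    √(D θ (speed θ k)) = (offset θ k - 2 * coupling θ ^ 2) / gapRoot θ k := by
  have hq := gapRoot_pos ha k
  have h := gapRoot_sq ha k
  rw [show D θ (speed θ k) = ((offset θ k - 2 * coupling θ ^ 2) / gapRoot θ k) ^ 2 by
    rw [D_eq, speed, div_pow, div_pow, h]
    have : offset θ k ^ 2 - coupling θ ^ 2 ≠ 0 := (gapRoot_arg_pos ha k).ne'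
    field_simp; ring]
  exact Real.sqrt_sq (div_pos (offset_sub_pos ha k) hq).le

theorem four_sub_speed_sq {θ : ℝ} (ha : |coupling θ| < 1 / 2) (k : ℝ) :
    4 - speed θ k ^ 2 = (4 * offset θ k - 1 - 4 * coupling θ ^ 2) / gapRoot θ k ^ 2 := by
  have hq := gapRoot_pos ha k
  rw [eq_div_iff (by positivity), sub_mul, gapRoot_sq ha, speed_sq ha]; ring

theorem four_sub_speed_sq_pos {θ : ℝ} (ha : |coupling θ| < 1 / 2)
    (k : ℝ) : 0 < 4 - speed θ k ^ 2 := by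
  rw [four_sub_speed_sq ha]
  exact div_pos (four_mul_offset_sub_pos ha k) (pow_pos (gapRoot_pos ha k) 2)

/-- Solves the dispersion relation for w: by `speed_sq`, w is a root of (4 - v²)w² - 4w + 1 + a²v² =
0, whose quarter discriminant is v²D(v), and the plus sign is the right one. Injectivity of the
speed and the factorisation of W₊ and W₋ both come from here. -/
theorem offset_mul_four_sub {θ : ℝ} (ha : |coupling θ| < 1 / 2) (k : ℝ) :
    offset θ k * (4 - speed θ k ^ 2) = 2 + speed θ k * √(D θ (speed θ k)) := by
  have hq := (gapRoot_pos ha k).ne'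
  have h := gapRoot_sq ha k
  rw [four_sub_speed_sq ha, sqrt_D_speed ha, speed]
  field_simp
  linear_combination -2 * h

theorem hasDerivAt_gapRoot {θ : ℝ} (ha : |coupling θ| < 1 / 2) (k : ℝ) :
    HasDerivAt (gapRoot θ)
      (offset θ k * (coupling θ * Real.sin k) / gapRoot θ k) k := by
  have h : HasDerivAt (gapRoot θ) _ k :=
    (((hasDerivAt_offset θ k).pow 2).sub_const (coupling θ ^ 2)).sqrt
      (gapRoot_arg_pos ha k).ne'
  refine h.congr_deriv ?_
  have := (gapRoot_pos ha k).ne'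
  change _ / (2 * gapRoot θ k) = _
  field_simp
  simp
  ring

theorem hasDerivAt_speed {θ : ℝ} (ha : |coupling θ| < 1 / 2) (k : ℝ) :
    HasDerivAt (speed θ)
      ((offset θ k - 2 * coupling θ ^ 2) * (coupling θ * Real.sin k) / gapRoot θ k ^ 3) k := by
  have h : HasDerivAt (speed θ) _ k :=
    (((hasDerivAt_offset θ k).const_mul 2).sub_const 1).div (hasDerivAt_gapRoot ha k)
      (gapRoot_pos ha k).ne'
  refine h.congr_deriv ?_
  have hq := (gapRoot_pos ha k).ne'
  have h2 := gapRoot_sq ha k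
  field_simp
  rw [h2]
  ring

theorem continuous_gapRoot {θ : ℝ} (ha : |coupling θ| < 1 / 2) : Continuous (gapRoot θ) :=
  continuous_iff_continuousAt.2 fun k => (hasDerivAt_gapRoot ha k).continuousAt

theorem continuous_speed {θ : ℝ} (ha : |coupling θ| < 1 / 2) : Continuous (speed θ) :=
  continuous_iff_continuousAt.2 fun k => (hasDerivAt_speed ha k).continuousAt

theorem continuous_bias {θ : ℝ} (ha : |coupling θ| < 1 / 2)
    (α β : ℂ) : Continuous (bias θ α β) := by
  have h1 := continuous_gapRoot ha
  have h2 := continuous_offset θ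
  unfold bias
  exact Continuous.div (by fun_prop) h1 fun k => (gapRoot_pos ha k).ne'

theorem injOn_speed {θ : ℝ} (ha : |coupling θ| < 1 / 2)
    (h0 : coupling θ ≠ 0) : Set.InjOn (speed θ) (Set.Icc 0 Real.pi) := by
  intro k hk l hl h
  have h1 := offset_mul_four_sub ha k
  have h2 := offset_mul_four_sub ha l
  rw [← h, ← h1] at h2
  have h3 := mul_right_cancel₀ (four_sub_speed_sq_pos ha k).ne' h2
  refine Real.injOn_cos hk hl ?_
  simp only [offset] at h3
  exact mul_left_cancel₀ h0 (by linarith)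

/-- The prefactor of ν cancels: with v the speed and q = `gapRoot`, c²v - √D = (2c² - 1)(w - c²)/q
and s²v - √D = -(2c² - 1)(w - s²)/q. -/
theorem nu_speed {θ : ℝ} (ha : |coupling θ| < 1 / 2)
    (α β : ℂ) (h0 : 2 * Real.cos θ ^ 2 - 1 ≠ 0) (k : ℝ) :
    nu 1 θ α β (speed θ k) = bias θ α β k := by
  have hq := (gapRoot_pos ha k).ne'
  have hc := four_mul_coupling_sq θ
  rw [nu, sqrt_D_speed ha, bias, speed, Real.sin_sq]
  field_simp
  generalize (α * star β + star α * β).re = R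
  linear_combination (‖α‖ ^ 2 - ‖β‖ ^ 2 - R) / 2 * hc

/-- Cauchy–Schwarz for two plane vectors: two components of the Bloch vector of the coin state, and
two components of the unit vector n(k). It makes the density nonnegative. -/
theorem abs_bias_le {θ : ℝ} (ha : |coupling θ| < 1 / 2)
    (α β : ℂ) (hαβ : ‖α‖ ^ 2 + ‖β‖ ^ 2 = 1) (k : ℝ) : |bias θ α β k| ≤ 1 := by
  have hq := gapRoot_pos ha k
  have h2 := gapRoot_sq ha k
  have hw := offset_mem θ k
  have hc := four_mul_coupling_sq θ
  set R := (α * star β + star α * β).re with hR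
  have hRle : (‖α‖ ^ 2 - ‖β‖ ^ 2) ^ 2 + R ^ 2 ≤ 1 := by
    have h1 : |R| ≤ 2 * (‖α‖ * ‖β‖) := by
      refine (Complex.abs_re_le_norm _).trans ((norm_add_le _ _).trans_eq ?_)
      simp only [norm_mul, norm_star]; ring
    have h3 : R ^ 2 ≤ (2 * (‖α‖ * ‖β‖)) ^ 2 := by
      rw [← sq_abs R]; gcongr
    nlinarith
  rw [bias, ← hR, abs_div, abs_of_pos hq, div_le_one hq]
  refine abs_le_of_sq_le_sq ?_ hq.le
  have key : (offset θ k - Real.cos θ ^ 2) ^ 2 + (offset θ k - Real.sin θ ^ 2) ^ 2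
      ≤ gapRoot θ k ^ 2 := by
    have h5 : (1 - offset θ k) ^ 2 ≤ coupling θ ^ 2 := by
      rw [← sq_abs (coupling θ)]; nlinarith [hw.1, hw.2]
    rw [h2, Real.sin_sq]
    nlinarith
  generalize offset θ k - Real.cos θ ^ 2 = A at key ⊢
  generalize offset θ k - Real.sin θ ^ 2 = B at key ⊢
  generalize ‖α‖ ^ 2 - ‖β‖ ^ 2 = P at hRle ⊢
  nlinarith [sq_nonneg (A * R - B * P), sq_nonneg A, sq_nonneg B,
    mul_le_mul_of_nonneg_left hRle (add_nonneg (sq_nonneg A) (sq_nonneg B))]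

theorem speed_mem {θ : ℝ} (ha : |coupling θ| < 1 / 2)
    (hθ : θ ∈ Set.Ioo 0 Real.pi) (h0 : coupling θ ≠ 0) {k : ℝ}
    (hk : k ∈ Set.Ioo 0 Real.pi) : speed θ k ∈ Set.Ioo (innerEdge θ) (outerEdge θ) := by
  have hx := speed_sq ha k
  have hp := speed_pos ha k
  have hw := offset_mem_Ioo h0 hk
  have hg := gapRoot_arg_pos ha k
  rw [innerEdge, outerEdge, cs_eq hθ]
  rw [← sq_abs (coupling θ)] at hx hg
  set b := |coupling θ|
  have hb : 0 ≤ b := abs_nonneg _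
  set w := offset θ k
  -- These are the cofactors left after dividing out the root w = 1 - b or w = 1 + b at which the
  -- edge is attained. Both increase in w; at w = 1 - b they equal 2(1 - 2b)(1 + b) and 2(1 - 2b).
  have e1 : 0 < (3 + 2 * b) * w - (1 + b + 2 * b ^ 2) := by nlinarith [hw.1, hw.2]
  have e2 : 0 < (3 - 2 * b) * w - (1 - b + 2 * b ^ 2) := by nlinarith [hw.1, hw.2]
  constructor
  · rw [Real.sqrt_lt' hp]
    refine lt_of_mul_lt_mul_right ?_ hg.le
    rw [hx]
    linarith [mul_pos (sub_pos.2 hw.1) e1,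
      show (2 * w - 1) ^ 2 - (1 - 2 * b) * (w ^ 2 - b ^ 2)
        = (w - (1 - b)) * ((3 + 2 * b) * w - (1 + b + 2 * b ^ 2)) by ring]
  · rw [Real.lt_sqrt hp.le]
    refine lt_of_mul_lt_mul_right ?_ hg.le
    rw [hx]
    linarith [mul_pos (sub_pos.2 hw.2) e2,
      show (1 + 2 * b) * (w ^ 2 - b ^ 2) - (2 * w - 1) ^ 2
        = (1 + b - w) * ((3 - 2 * b) * w - (1 - b + 2 * b ^ 2)) by ring]

theorem speed_zero {θ : ℝ} (ha : |coupling θ| < 1 / 2) : speed θ 0 = √(1 - 2 * coupling θ) := by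
  have h : 0 < 1 - 2 * coupling θ := by linarith [(abs_lt.1 ha).2]
  simp only [speed, gapRoot, offset, Real.cos_zero]
  rw [show (1 - coupling θ * 1) ^ 2 - coupling θ ^ 2 = 1 - 2 * coupling θ by ring,
    show 2 * (1 - coupling θ * 1) - 1 = 1 - 2 * coupling θ by ring, Real.div_sqrt]

theorem speed_pi {θ : ℝ} (ha : |coupling θ| < 1 / 2)
    : speed θ Real.pi = √(1 + 2 * coupling θ) := by
  have h : 0 < 1 + 2 * coupling θ := by linarith [(abs_lt.1 ha).1]
  simp only [speed, gapRoot, offset, Real.cos_pi]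
  rw [show (1 - coupling θ * -1) ^ 2 - coupling θ ^ 2 = 1 + 2 * coupling θ by ring,
    show 2 * (1 - coupling θ * -1) - 1 = 1 + 2 * coupling θ by ring, Real.div_sqrt]

theorem image_speed {θ : ℝ} (ha : |coupling θ| < 1 / 2)
    (hθ : θ ∈ Set.Ioo 0 Real.pi) (h0 : coupling θ ≠ 0) :
    speed θ '' Set.Ioo 0 Real.pi = Set.Ioo (innerEdge θ) (outerEdge θ) := by
  refine Set.Subset.antisymm ?_ ?_
  · rintro _ ⟨k, hk, rfl⟩
    exact speed_mem ha hθ h0 hk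
  · have hc := (continuous_speed ha).continuousOn (s := Set.Icc 0 Real.pi)
    rw [innerEdge, outerEdge, cs_eq hθ]
    -- The sign of a decides whether k = 0 or k = π gives the inner edge.
    rcases le_total 0 (coupling θ) with h | h
    · have := intermediate_value_Ioo Real.pi_pos.le hc
      rwa [speed_zero ha, speed_pi ha, ← abs_of_nonneg h] at this
    · have := intermediate_value_Ioo' Real.pi_pos.le hc
      rw [speed_zero ha, speed_pi ha] at this
      rwa [abs_of_nonpos h, mul_neg, sub_neg_eq_add, ← sub_eq_add_neg]

/-- The expression inside the absolute value is the derivative from `hasDerivAt_speed`. At x = v(k),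
W₊ = (4 - v²)(w - (1 - b)) and W₋ = (4 - v²)(1 + b - w), so their product is ((4 - v²) b sin k)². -/
theorem abs_deriv_mul_f_speed {θ : ℝ} (ha : |coupling θ| < 1 / 2)
    (hθ : θ ∈ Set.Ioo 0 Real.pi) (h0 : coupling θ ≠ 0) {k : ℝ}
    (hk : k ∈ Set.Ioo 0 Real.pi) :
    |(offset θ k - 2 * coupling θ ^ 2) * (coupling θ * Real.sin k) / gapRoot θ k ^ 3|
      * f θ (speed θ k) = 1 / (2 * Real.pi) := by
  have hs := Real.sin_pos_of_mem_Ioo hk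
  have hq := gapRoot_pos ha k
  have hE := four_mul_offset_sub_pos ha k
  have hG := offset_sub_pos ha k
  have hF := four_sub_speed_sq_pos ha k
  have hw := offset_mem_Ioo h0 hk
  have hm := offset_mul_four_sub ha k
  have hb : 0 < |coupling θ| := abs_pos.2 h0
  have hWp : Wplus θ (speed θ k)
      = (4 - speed θ k ^ 2) * (offset θ k - (1 - |coupling θ|)) := by
    rw [Wplus, cs_eq hθ]; linear_combination -hm
  have hWm : Wminus θ (speed θ k)
      = (4 - speed θ k ^ 2) * (1 + |coupling θ| - offset θ k) := by
    rw [Wminus, cs_eq hθ]; linear_combination hm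
  have hW : √(Wplus θ (speed θ k)) * √(Wminus θ (speed θ k))
      = (4 - speed θ k ^ 2) * (|coupling θ| * Real.sin k) := by
    rw [← Real.sqrt_mul (by rw [hWp]; exact mul_nonneg hF.le (sub_nonneg.2 hw.1.le)), hWp, hWm,
      ← Real.sqrt_sq (by positivity : 0 ≤ (4 - speed θ k ^ 2) * (|coupling θ| * Real.sin k))]
    congr 1
    have h1 : Real.sin k ^ 2 = 1 - Real.cos k ^ 2 := Real.sin_sq k
    rw [mul_pow, mul_pow, h1, offset]
    linear_combination (4 - speed θ k ^ 2) ^ 2 * Real.cos k ^ 2 * sq_abs (coupling θ)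
  have hsum : speed θ k + 2 * √(D θ (speed θ k))
      = (4 * offset θ k - 1 - 4 * coupling θ ^ 2) / gapRoot θ k := by
    rw [sqrt_D_speed ha, speed]; ring
  rw [f, mul_assoc _ (√(Wplus θ (speed θ k))), hW, hsum, four_sub_speed_sq ha, sqrt_D_speed ha,
    abs_div, abs_mul, abs_mul, abs_of_pos hG, abs_of_pos hs, abs_of_pos (pow_pos hq 3)]
  have := Real.pi_pos
  generalize 4 * offset θ k - 1 - 4 * coupling θ ^ 2 = E at hE ⊢
  field_simp

/-! ### The limit density as an image of the uniform law in k. -/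

/-- The part of the limit density carried by one sign of the velocity, as a function of the
speed. -/
def branch (ε θ : ℝ) (α β : ℂ) (x : ℝ) : ℝ :=
  f θ x * (1 - ε * nu 1 θ α β x) * (Set.Ioo (innerEdge θ) (outerEdge θ)).indicator 1 x

/-- Makes the second summand of the density a reflected `branch` with ε = -1, so that one change of
variables serves both. -/
theorem nu_neg_one (θ : ℝ) (α β : ℂ) (x : ℝ) : nu (-1) θ α β x = -nu 1 θ α β (-x) := by
  simp only [nu, D, neg_sq]; ring

theorem density_eq (θ : ℝ) (α β : ℂ) (x : ℝ) :
    density θ α β x = branch 1 θ α β x + branch (-1) θ α β (-x) := by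
  rw [density, nu_neg_one, branch, branch]; ring

theorem measurable_density (θ : ℝ) (α β : ℂ) : Measurable (density θ α β) := by
  have h : Measurable ((Set.Ioo (innerEdge θ) (outerEdge θ)).indicator (1 : ℝ → ℝ)) :=
    measurable_one.indicator measurableSet_Ioo
  unfold density f nu Wplus Wminus D
  fun_prop

theorem branch_eq_zero {ε θ : ℝ} {α β : ℂ} {x : ℝ}
    (hx : x ∉ Set.Ioo (innerEdge θ) (outerEdge θ)) : branch ε θ α β x = 0 := by
  rw [branch, Set.indicator_of_notMem hx, mul_zero]

theorem support_density_subset (θ : ℝ) (α β : ℂ) :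
    Function.support (density θ α β) ⊆
      Set.Ioo (-outerEdge θ) (-innerEdge θ) ∪ Set.Ioo (innerEdge θ) (outerEdge θ) := by
  intro x hx
  by_contra h
  rw [Set.mem_union, not_or] at h
  refine hx ?_
  rw [density_eq, branch_eq_zero h.2, branch_eq_zero, add_zero]
  intro h'
  exact h.1 ⟨by linarith [h'.2], by linarith [h'.1]⟩

theorem branch_nonneg {θ : ℝ} (hθ : θ ∈ Set.Ioo 0 Real.pi) (hc : 2 * Real.cos θ ^ 2 - 1 ≠ 0)
    (h0 : coupling θ ≠ 0) {α β : ℂ} (hαβ : ‖α‖ ^ 2 + ‖β‖ ^ 2 = 1) {ε : ℝ} (hε : |ε| ≤ 1) (x : ℝ) :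
    0 ≤ branch ε θ α β x := by
  have ha := abs_coupling_lt hc
  by_cases hx : x ∈ Set.Ioo (innerEdge θ) (outerEdge θ)
  · rw [branch, Set.indicator_of_mem hx, Pi.one_apply, mul_one]
    rw [← image_speed ha hθ h0] at hx
    obtain ⟨k, hk, rfl⟩ := hx
    refine mul_nonneg ?_ ?_
    · rw [f]
      have := four_sub_speed_sq_pos ha k
      have := Real.pi_pos
      positivity
    · rw [nu_speed ha α β hc, sub_nonneg]
      refine (le_abs_self _).trans ?_
      rw [abs_mul]
      exact mul_le_one₀ hε (abs_nonneg _) (abs_bias_le ha α β hαβ k)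
  · rw [branch_eq_zero hx]

theorem density_nonneg {θ : ℝ} (hθ : θ ∈ Set.Ioo 0 Real.pi) (hc : 2 * Real.cos θ ^ 2 - 1 ≠ 0)
    (h0 : coupling θ ≠ 0) {α β : ℂ} (hαβ : ‖α‖ ^ 2 + ‖β‖ ^ 2 = 1) (x : ℝ) :
    0 ≤ density θ α β x := by
  rw [density_eq]
  exact add_nonneg (branch_nonneg hθ hc h0 hαβ (by simp) _)
    (branch_nonneg hθ hc h0 hαβ (by simp) _)

theorem abs_deriv_smul_branch {θ : ℝ} (hθ : θ ∈ Set.Ioo 0 Real.pi)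
    (hc : 2 * Real.cos θ ^ 2 - 1 ≠ 0) (h0 : coupling θ ≠ 0) (ε : ℝ) (α β : ℂ) (G : ℝ → ℂ) {k : ℝ}
    (hk : k ∈ Set.Ioo 0 Real.pi) :
    |(offset θ k - 2 * coupling θ ^ 2) * (coupling θ * Real.sin k) / gapRoot θ k ^ 3|
        • (branch ε θ α β (speed θ k) * G (speed θ k) : ℂ)
      = ((1 / (2 * Real.pi) * (1 - ε * bias θ α β k) : ℝ) : ℂ) * G (speed θ k) := by
  have ha := abs_coupling_lt hc
  rw [branch, Set.indicator_of_mem (speed_mem ha hθ h0 hk), nu_speed ha α β hc,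
    ← abs_deriv_mul_f_speed ha hθ h0 hk, Complex.real_smul]
  simp only [Pi.one_apply]
  push_cast
  ring

/-- f blows up at the edges of 𝒟, but in the variable k the Jacobian absorbs the singularity and the
integrand is continuous on [0,π]. -/
theorem integrable_branch_mul {θ : ℝ} (hθ : θ ∈ Set.Ioo 0 Real.pi)
    (hc : 2 * Real.cos θ ^ 2 - 1 ≠ 0) (h0 : coupling θ ≠ 0)
    (ε : ℝ) (α β : ℂ) {G : ℝ → ℂ} (hG : Continuous G) :
    Integrable fun x => (branch ε θ α β x * G x : ℂ) := by
  have ha := abs_coupling_lt hc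
  have h1 := continuous_speed ha
  have h2 := continuous_bias ha α β
  have hon : IntegrableOn (fun x => (branch ε θ α β x * G x : ℂ))
      (Set.Ioo (innerEdge θ) (outerEdge θ)) := by
    rw [← image_speed ha hθ h0, integrableOn_image_iff_integrableOn_abs_deriv_smul
      measurableSet_Ioo (fun k _ => (hasDerivAt_speed ha k).hasDerivWithinAt)
      ((injOn_speed ha h0).mono Set.Ioo_subset_Icc_self)]
    refine IntegrableOn.congr_fun ?_
      (fun k hk => (abs_deriv_smul_branch hθ hc h0 ε α β G hk).symm) measurableSet_Ioo
    refine (Continuous.integrableOn_Icc ?_).mono_set Set.Ioo_subset_Icc_self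
    fun_prop
  refine (integrableOn_iff_integrable_of_support_subset fun x hx => ?_).1 hon
  by_contra h
  exact hx (by simp [branch_eq_zero h])

theorem integral_branch_mul {θ : ℝ} (hθ : θ ∈ Set.Ioo 0 Real.pi) (hc : 2 * Real.cos θ ^ 2 - 1 ≠ 0)
    (h0 : coupling θ ≠ 0) (ε : ℝ) (α β : ℂ) (G : ℝ → ℂ) :
    ∫ x, (branch ε θ α β x * G x : ℂ)
      = ∫ k in (0)..Real.pi,
          ((1 / (2 * Real.pi) * (1 - ε * bias θ α β k) : ℝ) : ℂ) * G (speed θ k) := by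
  have ha := abs_coupling_lt hc
  rw [← setIntegral_eq_integral_of_forall_compl_eq_zero
      (s := Set.Ioo (innerEdge θ) (outerEdge θ)) fun x hx => by simp [branch_eq_zero hx],
    ← image_speed ha hθ h0, integral_image_eq_integral_abs_deriv_smul
      measurableSet_Ioo (fun k _ => (hasDerivAt_speed ha k).hasDerivWithinAt)
      ((injOn_speed ha h0).mono Set.Ioo_subset_Icc_self),
    intervalIntegral.integral_of_le Real.pi_pos.le, integral_Ioc_eq_integral_Ioo]
  exact setIntegral_congr_fun measurableSet_Ioo
    fun k hk => abs_deriv_smul_branch hθ hc h0 ε α β G hk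

theorem integrable_density_mul {θ : ℝ} (hθ : θ ∈ Set.Ioo 0 Real.pi)
    (hc : 2 * Real.cos θ ^ 2 - 1 ≠ 0) (h0 : coupling θ ≠ 0)
    (α β : ℂ) {G : ℝ → ℂ} (hG : Continuous G) :
    Integrable fun x => (density θ α β x * G x : ℂ) := by
  have h1 := integrable_branch_mul hθ hc h0 1 α β hG
  have h2 := (integrable_branch_mul hθ hc h0 (-1) α β (hG.comp continuous_neg)).comp_neg
  refine (h1.add h2).congr (.of_forall fun x => ?_)
  simp only [Pi.add_apply, Function.comp_apply, neg_neg, density_eq]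
  push_cast
  ring

/-- Integration against the limit density, in terms of the wave number. -/
theorem integral_density_mul {θ : ℝ} (hθ : θ ∈ Set.Ioo 0 Real.pi)
    (hc : 2 * Real.cos θ ^ 2 - 1 ≠ 0) (h0 : coupling θ ≠ 0)
    (α β : ℂ) {G : ℝ → ℂ} (hG : Continuous G) :
    ∫ x, (density θ α β x * G x : ℂ)
      = ∫ k in (0)..Real.pi, (1 / (2 * Real.pi) : ℂ) *
          ((1 - bias θ α β k) * G (speed θ k) + (1 + bias θ α β k) * G (-speed θ k)) := by
  have ha := abs_coupling_lt hc
  have c1 := continuous_speed ha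
  have c2 := continuous_bias ha α β
  have h1 := integrable_branch_mul hθ hc h0 1 α β hG
  have h2 := (integrable_branch_mul hθ hc h0 (-1) α β (hG.comp continuous_neg)).comp_neg
  calc ∫ x, (density θ α β x * G x : ℂ)
      = ∫ x, ((branch 1 θ α β x * G x : ℂ)
          + (branch (-1) θ α β (-x) * (G ∘ Neg.neg) (-x) : ℂ)) := by
        congr 1 with x
        simp only [Function.comp_apply, neg_neg, density_eq]
        push_cast
        ring
    _ = _ := by
        rw [integral_add h1 h2,
          integral_neg_eq_self (fun x => (branch (-1) θ α β x * (G ∘ Neg.neg) x : ℂ)) volume,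
          integral_branch_mul hθ hc h0, integral_branch_mul hθ hc h0,
          ← intervalIntegral.integral_add]
        · congr 1 with k
          simp only [Function.comp_apply]
          push_cast
          ring
        · exact Continuous.intervalIntegrable (by fun_prop) _ _
        · exact Continuous.intervalIntegrable (by fun_prop) _ _

theorem integrable_density {θ : ℝ} (hθ : θ ∈ Set.Ioo 0 Real.pi) (hc : 2 * Real.cos θ ^ 2 - 1 ≠ 0)
    (h0 : coupling θ ≠ 0) (α β : ℂ) : Integrable (density θ α β) := by
  have h := (integrable_density_mul hθ hc h0 α β (G := fun _ => 1) continuous_const).re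
  simpa using h

theorem integral_density {θ : ℝ} (hθ : θ ∈ Set.Ioo 0 Real.pi) (hc : 2 * Real.cos θ ^ 2 - 1 ≠ 0)
    (h0 : coupling θ ≠ 0) (α β : ℂ) : ∫ x, density θ α β x = 1 := by
  have h := integral_density_mul hθ hc h0 α β (G := fun _ => 1) continuous_const
  have h2 : ∀ k, (1 / (2 * Real.pi) : ℂ) *
      (1 - bias θ α β k + (1 + bias θ α β k)) = 1 / Real.pi := fun k => by
    have : (Real.pi : ℂ) ≠ 0 := by exact_mod_cast Real.pi_ne_zero
    field_simp
    ring
  simp only [h2, mul_one, integral_complex_ofReal, intervalIntegral.integral_const, sub_zero,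
    Complex.real_smul] at h
  rw [mul_one_div_cancel (by exact_mod_cast Real.pi_ne_zero)] at h
  exact_mod_cast h

/-! ### Fourier symbols of the two operations. -/

/-- The operator on the coin space given by a matrix. -/
abbrev coinOp (M : Matrix (Fin 2) (Fin 2) ℂ) : Coin →L[ℂ] Coin :=
  Matrix.toEuclideanCLM (𝕜 := ℂ) M

theorem coinOp_add_apply (M N : Matrix (Fin 2) (Fin 2) ℂ) (v : Coin) :
    coinOp (M + N) v = coinOp M v + coinOp N v := by
  rw [coinOp, map_add, add_apply]

theorem coinOp_smul_apply (a : ℂ) (M : Matrix (Fin 2) (Fin 2) ℂ) (v : Coin) :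
    coinOp (a • M) v = a • coinOp M v := by
  rw [coinOp, map_smul, smul_apply]

theorem coinOp_mul_apply (M N : Matrix (Fin 2) (Fin 2) ℂ) (v : Coin) :
    coinOp (M * N) v = coinOp M (coinOp N v) := by
  rw [coinOp, map_mul, mul_apply_eq_comp]

/-- The plane wave `x ↦ exp (-i k x)`. -/
def wave (k : ℝ) (x : ℤ) : ℂ := Complex.exp (-(k * x : ℝ) * I)

theorem wave_add (k : ℝ) (x y : ℤ) : wave k (x + y) = wave k x * wave k y := by
  rw [wave, wave, wave, ← Complex.exp_add]; congr 1; push_cast; ring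

/-- Translation becomes multiplication by a phase. Working with `HasSum` at each k avoids any L²
Fourier transform: the walk has finite support at every time. -/
theorem hasSum_wave_shift {k : ℝ} {Ψ : State} {v : Coin}
    (h : HasSum (fun x : ℤ => wave k x • Ψ x) v) (d : ℤ) (M : Matrix (Fin 2) (Fin 2) ℂ) :
    HasSum (fun x : ℤ => wave k x • shift d M Ψ x) (coinOp (wave k d • M) v) := by
  have h1 := (Equiv.subRight d).hasSum_iff.2 ((h.mapL (coinOp M)).const_smul (wave k d))
  rw [coinOp_smul_apply]
  refine h1.congr_fun fun x => ?_
  simp only [Function.comp_apply, Equiv.subRight_apply, map_smul, smul_smul]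
  rw [← wave_add, add_sub_cancel]
  rfl

theorem wave_zero_right (k : ℝ) : wave k 0 = 1 := by simp [wave]

theorem wave_one (k : ℝ) : wave k 1 = Real.cos k - Real.sin k * I := by
  rw [wave, Int.cast_one, mul_one, ← Complex.ofReal_neg, Complex.exp_mul_I,
    ← Complex.ofReal_cos, ← Complex.ofReal_sin, Real.cos_neg, Real.sin_neg]
  push_cast
  ring

theorem wave_neg_one (k : ℝ) : wave k (-1) = Real.cos k + Real.sin k * I := by
  simp [wave, Complex.exp_mul_I]

/-- The Fourier symbol of `U₁`. -/
def symbol₁ (θ k : ℝ) : Matrix (Fin 2) (Fin 2) ℂ :=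
  !![(Real.cos θ * Real.cos k : ℝ), Real.sin θ + (Real.cos θ * Real.sin k : ℝ) * I;
     Real.sin θ - (Real.cos θ * Real.sin k : ℝ) * I, -(Real.cos θ * Real.cos k : ℝ)]

/-- The Fourier symbol of `U₂`. -/
def symbol₂ (θ k : ℝ) : Matrix (Fin 2) (Fin 2) ℂ :=
  !![(Real.cos θ : ℂ), Real.sin θ * (Real.cos k + Real.sin k * I);
     Real.sin θ * (Real.cos k - Real.sin k * I), -Real.cos θ]

theorem hasSum_wave_U₁ {θ k : ℝ} {Ψ : State} {v : Coin}
    (h : HasSum (fun x : ℤ => wave k x • Ψ x) v) :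
    HasSum (fun x : ℤ => wave k x • U₁ θ Ψ x) (coinOp (symbol₁ θ k) v) := by
  have := ((hasSum_wave_shift h (-1) (((Real.cos θ / 2 : ℝ) : ℂ) • !![1, 1; -1, -1])).add
    (hasSum_wave_shift h 0 (((Real.sin θ : ℝ) : ℂ) • !![0, 1; 1, 0]))).add
    (hasSum_wave_shift h 1 (((Real.cos θ / 2 : ℝ) : ℂ) • !![1, -1; 1, -1]))
  convert this using 1
  · ext1 x
    simp only [← smul_add]
    rfl
  · rw [← coinOp_add_apply, ← coinOp_add_apply,
      wave_one, wave_neg_one, wave_zero_right]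
    congr 2
    ext i j
    fin_cases i <;> fin_cases j <;> simp [symbol₁] <;> ring

theorem hasSum_wave_U₂ {θ k : ℝ} {Ψ : State} {v : Coin}
    (h : HasSum (fun x : ℤ => wave k x • Ψ x) v) :
    HasSum (fun x : ℤ => wave k x • U₂ θ Ψ x) (coinOp (symbol₂ θ k) v) := by
  have := ((hasSum_wave_shift h (-1) (((Real.sin θ : ℝ) : ℂ) • !![0, 1; 0, 0])).add
    (hasSum_wave_shift h 0 (((Real.cos θ : ℝ) : ℂ) • !![1, 0; 0, -1]))).add
    (hasSum_wave_shift h 1 (((Real.sin θ : ℝ) : ℂ) • !![0, 0; 1, 0]))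
  convert this using 1
  · ext1 x
    simp only [← smul_add]
    rfl
  · rw [← coinOp_add_apply, ← coinOp_add_apply,
      wave_one, wave_neg_one, wave_zero_right]
    congr 2
    ext i j
    fin_cases i <;> fin_cases j <;> simp [symbol₂] <;> ring

/-! ### Spectral decomposition of the symbol of the walk. -/

/-- The eigenvalue `exp (i φ(k))` of the symbol of the walk, on the branch that is smooth in `k`. -/
def band (θ k : ℝ) : ℂ :=
  (Real.cos k + coupling θ * Real.sin k ^ 2 : ℝ) + (Real.sin k * gapRoot θ k : ℝ) * I

/-- The reflection `n(k) · σ` whose eigenspaces are those of the symbol of the walk. -/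
def axis (θ k : ℝ) : Matrix (Fin 2) (Fin 2) ℂ :=
  ((1 / gapRoot θ k : ℝ) : ℂ) •
    !![((offset θ k - Real.cos θ ^ 2 : ℝ) : ℂ),
        (offset θ k - Real.sin θ ^ 2 : ℝ) - (coupling θ * Real.sin k : ℝ) * I;
       (offset θ k - Real.sin θ ^ 2 : ℝ) + (coupling θ * Real.sin k : ℝ) * I,
        -((offset θ k - Real.cos θ ^ 2 : ℝ) : ℂ)]

theorem axis_mul_self {θ : ℝ} (ha : |coupling θ| < 1 / 2) (k : ℝ) : axis θ k * axis θ k = 1 := by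
  have hq := (gapRoot_pos ha k).ne'
  have h2 := gapRoot_sq ha k
  have key : (offset θ k - Real.cos θ ^ 2) ^ 2 + (offset θ k - Real.sin θ ^ 2) ^ 2
      + (coupling θ * Real.sin k) ^ 2 = gapRoot θ k ^ 2 := by
    have h3 := four_mul_coupling_sq θ
    rw [h2, Real.sin_sq, mul_pow, Real.sin_sq, offset]
    linear_combination (1 / 2) * h3
  generalize hA : offset θ k - Real.cos θ ^ 2 = A at key
  generalize hB : offset θ k - Real.sin θ ^ 2 = B at key
  generalize hC : coupling θ * Real.sin k = C at key
  rw [axis, hA, hB, hC]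
  generalize gapRoot θ k = q at *
  have key' : (A ^ 2 + B ^ 2 + C ^ 2 : ℂ) = q ^ 2 := by exact_mod_cast key
  have hq' : (q : ℂ) ≠ 0 := by exact_mod_cast hq
  rw [smul_mul_smul_comm]
  ext i j
  fin_cases i <;> fin_cases j <;> simp <;> field_simp
  · linear_combination key' - C ^ 2 * Complex.I_sq
  · right; ring
  · right; ring
  · linear_combination key' - C ^ 2 * Complex.I_sq

/-- Each symbol is Hermitian and traceless with determinant -1, so the product lies in SU(2) and has
the form cos φ + i sin φ n·σ. -/
theorem symbol_mul {θ : ℝ} (ha : |coupling θ| < 1 / 2) (k : ℝ) :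
    symbol₂ θ k * symbol₁ θ k = ((Real.cos k + coupling θ * Real.sin k ^ 2 : ℝ) : ℂ) • 1
      + ((Real.sin k * gapRoot θ k : ℝ) * I : ℂ) • axis θ k := by
  have hq : (gapRoot θ k : ℂ) ≠ 0 := by exact_mod_cast (gapRoot_pos ha k).ne'
  have h1 : (Real.sin θ ^ 2 : ℂ) = 1 - Real.cos θ ^ 2 := by exact_mod_cast Real.sin_sq θ
  have h2 : (Real.sin k ^ 2 : ℂ) = 1 - Real.cos k ^ 2 := by exact_mod_cast Real.sin_sq k
  have hI := Complex.I_sq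
  rw [axis, smul_smul]
  ext i j
  fin_cases i <;> fin_cases j <;>
    simp [Matrix.mul_apply, Fin.sum_univ_two, symbol₁, symbol₂, offset, coupling,
      -Complex.ofReal_cos, -Complex.ofReal_sin] <;> field_simp <;>
    generalize (Real.cos θ : ℂ) = c at * <;> generalize (Real.sin θ : ℂ) = s at * <;>
    generalize (Real.cos k : ℂ) = u at * <;> generalize (Real.sin k : ℂ) = v at * 
  · linear_combination (u + v * I) * h1 - c * s * v ^ 2 * hI
  · linear_combination v * I * h1 + c * s * v ^ 2 * hI - c * s * h2
  · linear_combination v * I * h1 - c * s * v ^ 2 * hI + c * s * h2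
  · linear_combination (u - v * I) * h1 - c * s * v ^ 2 * hI

/-- The spectral projections of the symbol of the walk, for `ε = 1` and `ε = -1`. -/
def proj (ε : ℂ) (θ k : ℝ) : Matrix (Fin 2) (Fin 2) ℂ := (1 / 2 : ℂ) • (1 + ε • axis θ k)

theorem add_smul_axis_mul_proj {θ : ℝ} (ha : |coupling θ| < 1 / 2)
    {ε : ℂ} (hε : ε = 1 ∨ ε = -1) (x y : ℂ) (k : ℝ) :
    (x • 1 + y • axis θ k) * proj ε θ k = (x + ε * y) • proj ε θ k := by
  have h := axis_mul_self ha k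
  simp only [proj, mul_smul_comm, smul_mul_assoc, add_mul, mul_add, one_mul, mul_one, h]
  obtain rfl | rfl := hε <;> module

theorem proj_mul_proj {θ : ℝ} (ha : |coupling θ| < 1 / 2)
    {ε : ℂ} (hε : ε = 1 ∨ ε = -1) (δ : ℂ) (k : ℝ) :
    proj δ θ k * proj ε θ k = ((1 + ε * δ) / 2) • proj ε θ k := by
  have h := add_smul_axis_mul_proj ha hε (1 / 2) (δ / 2) k
  rw [show (1 + ε * δ) / 2 = 1 / 2 + ε * (δ / 2) by ring, ← h, proj]
  congr 1
  module

theorem symbol_mul_proj_one {θ : ℝ} (ha : |coupling θ| < 1 / 2) (k : ℝ) :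
    symbol₂ θ k * symbol₁ θ k * proj 1 θ k = band θ k • proj 1 θ k := by
  rw [symbol_mul ha, add_smul_axis_mul_proj ha (.inl rfl), one_mul, band]

theorem symbol_mul_proj_neg_one {θ : ℝ} (ha : |coupling θ| < 1 / 2) (k : ℝ) :
    symbol₂ θ k * symbol₁ θ k * proj (-1) θ k = star (band θ k) • proj (-1) θ k := by
  rw [symbol_mul ha, add_smul_axis_mul_proj ha (.inr rfl), band]
  congr 1
  simp [-Complex.ofReal_cos, -Complex.ofReal_sin]

theorem isHermitian_proj {ε : ℂ} (hε : ε = 1 ∨ ε = -1) (θ k : ℝ) :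
    (proj ε θ k).IsHermitian := by
  obtain rfl | rfl := hε <;>
    (ext i j
     fin_cases i <;> fin_cases j <;> simp [proj, axis, -Complex.ofReal_cos, -Complex.ofReal_sin]
     all_goals ring_nf
     all_goals simp)

/-- The component of the initial state along an eigenvector of the symbol of the walk. -/
def component (ε : ℂ) (θ : ℝ) (α β : ℂ) (k : ℝ) : Coin := coinOp (proj ε θ k) !₂[α, β]

/-- The Fourier transform of the state at time `t`. -/
def amplitude (θ : ℝ) (α β : ℂ) (t : ℕ) (k : ℝ) : Coin :=
  band θ k ^ t • component 1 θ α β k + star (band θ k) ^ t • component (-1) θ α β k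

theorem component_add_component (θ : ℝ) (α β : ℂ) (k : ℝ) :
    component 1 θ α β k + component (-1) θ α β k = !₂[α, β] := by
  rw [component, component, ← coinOp_add_apply,
    show proj 1 θ k + proj (-1) θ k = 1 by simp only [proj]; module, coinOp, map_one]
  rfl

theorem inner_component (ε δ : ℂ) (hε : ε = 1 ∨ ε = -1) (hδ : δ = 1 ∨ δ = -1)
    {θ : ℝ} (ha : |coupling θ| < 1 / 2) (α β : ℂ) (k : ℝ) :
    inner ℂ (component ε θ α β k) (component δ θ α β k)
      = ((1 + δ * ε) / 2) * inner ℂ (!₂[α, β] : Coin) (component δ θ α β k) := by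
  rw [component, component, ← ContinuousLinearMap.adjoint_inner_right,
    ← ContinuousLinearMap.star_eq_adjoint, coinOp, ← map_star,
    Matrix.star_eq_conjTranspose, (isHermitian_proj hε θ k).eq, ← coinOp_mul_apply,
    proj_mul_proj ha hδ, coinOp_smul_apply, inner_smul_right]

/-- The weight of an eigenspace is (1 + ε⟨n·σ⟩)/2. The term with sin k is the odd part of ⟨n·σ⟩,
which drops out on integration over a symmetric interval. -/
theorem inner_component_self (ε : ℂ) (hε : ε = 1 ∨ ε = -1)
    {θ : ℝ} (ha : |coupling θ| < 1 / 2) (α β : ℂ) (hαβ : ‖α‖ ^ 2 + ‖β‖ ^ 2 = 1) (k : ℝ) :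
    inner ℂ (component ε θ α β k) (component ε θ α β k)
      = (1 + ε * (bias θ α β k
        + coupling θ * Real.sin k / gapRoot θ k * (2 * (star α * β).im) : ℝ)) / 2 := by
  have hq : (gapRoot θ k : ℂ) ≠ 0 := by exact_mod_cast (gapRoot_pos ha k).ne'
  have h1 : (1 + ε * ε) / 2 = 1 := by obtain rfl | rfl := hε <;> norm_num
  have hn : (‖α‖ ^ 2 + ‖β‖ ^ 2 : ℂ) = 1 := by exact_mod_cast hαβ
  have e1 := Complex.mul_conj' α
  have e2 := Complex.mul_conj' β
  have e3 : α * (starRingEnd ℂ) β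
      = (α.re * β.re + α.im * β.im) + (α.im * β.re - α.re * β.im) * I := by
    apply Complex.ext <;> simp
    ring
  have e4 : β * (starRingEnd ℂ) α
      = (α.re * β.re + α.im * β.im) - (α.im * β.re - α.re * β.im) * I := by
    apply Complex.ext <;> simp <;> ring
  rw [inner_component ε ε hε hε ha, h1, one_mul, component, bias]
  simp only [proj, axis, coinOp, Matrix.toEuclideanCLM_toLp, Fin.sum_univ_two, PiLp.inner_apply]
  simp [-Complex.ofReal_cos, -Complex.ofReal_sin]
  field_simp
  linear_combination gapRoot θ k * (e1 + e2 + hn) + ε * ((offset θ k - Real.cos θ ^ 2) * (e1 - e2)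
    + (offset θ k - Real.sin θ ^ 2 + coupling θ * Real.sin k * I) * e3
    + (offset θ k - Real.sin θ ^ 2 - coupling θ * Real.sin k * I) * e4
    + 2 * coupling θ * Real.sin k * (α.im * β.re - α.re * β.im) * Complex.I_sq)

theorem hasSum_wave_walk {θ : ℝ} (ha : |coupling θ| < 1 / 2) (α β : ℂ) (t : ℕ) (k : ℝ) :
    HasSum (fun x : ℤ => wave k x • walk θ α β t x) (amplitude θ α β t k) := by
  induction t with
  | zero =>
    have h := hasSum_single (f := fun x : ℤ => wave k x • walk θ α β 0 x) 0 fun x hx => by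
      simp [walk, lp.single_apply, hx]
    convert h using 1
    rw [amplitude, pow_zero, pow_zero, one_smul, one_smul, component_add_component,
      wave_zero_right, one_smul, walk, lp.single_apply_self]
  | succ t ih =>
    have h := hasSum_wave_U₂ (θ := θ) (hasSum_wave_U₁ (θ := θ) ih)
    have e : coinOp (symbol₂ θ k) (coinOp (symbol₁ θ k) (amplitude θ α β t k))
        = amplitude θ α β (t + 1) k := by
      rw [← coinOp_mul_apply, amplitude, amplitude, map_add, map_smul, map_smul, component,
        component, ← coinOp_mul_apply, ← coinOp_mul_apply, symbol_mul_proj_one ha,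
        symbol_mul_proj_neg_one ha, coinOp_smul_apply, coinOp_smul_apply, smul_smul, smul_smul,
        pow_succ, pow_succ]
    rw [e] at h
    exact h

/-! ### Finite propagation and the Parseval identity. -/

theorem shift_apply (d : ℤ) (M : Matrix (Fin 2) (Fin 2) ℂ) (Ψ : State) (x : ℤ) :
    shift d M Ψ x = coinOp M (Ψ (x - d)) := rfl

theorem shift_eq_zero {n : ℤ} {Ψ : State} (h : ∀ x, n < |x| → Ψ x = 0) {d : ℤ} (hd : |d| ≤ 1)
    (M : Matrix (Fin 2) (Fin 2) ℂ) : ∀ x, n + 1 < |x| → shift d M Ψ x = 0 := by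
  intro x hx
  rw [shift_apply, h, map_zero]
  have := abs_sub_abs_le_abs_sub x d
  omega

theorem U₁_eq_zero {n : ℤ} {Ψ : State} (h : ∀ x, n < |x| → Ψ x = 0) (θ : ℝ) :
    ∀ x, n + 1 < |x| → U₁ θ Ψ x = 0 := by
  intro x hx
  change shift _ _ Ψ x + shift _ _ Ψ x + shift _ _ Ψ x = 0
  rw [shift_eq_zero h (by simp) _ x hx, shift_eq_zero h (by simp) _ x hx,
    shift_eq_zero h (by simp) _ x hx, add_zero, add_zero]

theorem U₂_eq_zero {n : ℤ} {Ψ : State} (h : ∀ x, n < |x| → Ψ x = 0) (θ : ℝ) :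
    ∀ x, n + 1 < |x| → U₂ θ Ψ x = 0 := by
  intro x hx
  change shift _ _ Ψ x + shift _ _ Ψ x + shift _ _ Ψ x = 0
  rw [shift_eq_zero h (by simp) _ x hx, shift_eq_zero h (by simp) _ x hx,
    shift_eq_zero h (by simp) _ x hx, add_zero, add_zero]

theorem walk_eq_zero (θ : ℝ) (α β : ℂ) (t : ℕ) :
    ∀ x : ℤ, 2 * t < |x| → walk θ α β t x = 0 := by
  induction t with
  | zero =>
    intro x hx
    have : x ≠ 0 := by rintro rfl; simp at hx
    simp [walk, lp.single_apply, this]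
  | succ t ih =>
    intro x hx
    exact U₂_eq_zero (U₁_eq_zero ih θ) θ x (by push_cast at hx; omega)

/-- The positions that the walk can have reached at time `t`. -/
def reach (t : ℕ) : Finset ℤ := Finset.Icc (-(2 * t)) (2 * t)

theorem walk_eq_zero_of_notMem_reach (θ : ℝ) (α β : ℂ) {t : ℕ} {x : ℤ} (hx : x ∉ reach t) :
    walk θ α β t x = 0 :=
  walk_eq_zero θ α β t x (by rwa [reach, Finset.mem_Icc, ← abs_le, not_le] at hx)

theorem continuous_wave (x : ℤ) : Continuous fun k => wave k x := by
  unfold wave; fun_prop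

theorem wave_mul_star (k : ℝ) (x y : ℤ) : wave k y * star (wave k x) = wave k (y - x) := by
  simp only [wave, Complex.star_def, ← Complex.exp_conj, ← Complex.exp_add]
  congr 1
  simp
  ring

theorem wave_sub_left (k η : ℝ) (x : ℤ) : wave (k - η) x = wave k x * wave (-η) x := by
  rw [wave, wave, wave, ← Complex.exp_add]; congr 1; push_cast; ring

theorem integral_wave (n : ℤ) :
    ∫ k in (-Real.pi)..Real.pi, wave k n = if n = 0 then 2 * (Real.pi : ℂ) else 0 := by
  split_ifs with h
  · subst h
    simp [wave]
    ring
  · have hc : (-n * I : ℂ) ≠ 0 := by simp [h]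
    have : ∀ k : ℝ, wave k n = Complex.exp ((-n * I) * k) := fun k => by
      rw [wave]; congr 1; push_cast; ring
    simp only [this]
    rw [integral_exp_mul_complex hc, div_eq_zero_iff, sub_eq_zero]
    left
    rw [Complex.exp_eq_exp_iff_exists_int]
    exact ⟨-n, by push_cast; ring⟩

/-- The Parseval identity for a finitely supported state, with a shift of the wave number. -/
theorem integral_inner_sum_wave (S : Finset ℤ) (F : ℤ → Coin) (η : ℝ) :
    ∫ k in (-Real.pi)..Real.pi,
        inner ℂ (∑ x ∈ S, wave k x • F x) (∑ y ∈ S, wave (k - η) y • F y)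
      = 2 * Real.pi * ∑ x ∈ S, wave (-η) x * (‖F x‖ : ℂ) ^ 2 := by
  have h : ∀ k : ℝ, inner ℂ (∑ x ∈ S, wave k x • F x) (∑ y ∈ S, wave (k - η) y • F y)
      = ∑ x ∈ S, ∑ y ∈ S, wave k (y - x) * (wave (-η) y * inner ℂ (F x) (F y)) := fun k => by
    rw [sum_inner]
    refine Finset.sum_congr rfl fun x _ => ?_
    rw [inner_sum]
    refine Finset.sum_congr rfl fun y _ => ?_
    rw [inner_smul_left, inner_smul_right, wave_sub_left, ← wave_mul_star, ← Complex.star_def]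
    ring
  have hc : ∀ x y : ℤ, Continuous
      (fun k : ℝ => wave k (y - x) * (wave (-η) y * inner ℂ (F x) (F y))) := fun x y =>
    (continuous_wave _).mul continuous_const
  simp only [h]
  rw [intervalIntegral.integral_finsetSum, Finset.mul_sum]
  · refine Finset.sum_congr rfl fun x hx => ?_
    rw [intervalIntegral.integral_finsetSum fun y _ => (hc x y).intervalIntegrable _ _,
      Finset.sum_eq_single x]
    · rw [intervalIntegral.integral_mul_const, integral_wave, sub_self, if_pos rfl,
        inner_self_eq_norm_sq_to_K]
      rfl
    · intro y _ hy
      rw [intervalIntegral.integral_mul_const, integral_wave, if_neg (sub_ne_zero.2 hy), zero_mul]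
    · exact fun h => absurd hx h
  · exact fun x _ => (continuous_finsetSum _ fun y _ => hc x y).intervalIntegrable _ _

theorem inner_amplitude (θ : ℝ) (α β : ℂ) (t : ℕ) (k l : ℝ) :
    inner ℂ (amplitude θ α β t k) (amplitude θ α β t l)
      = (star (band θ k) * band θ l) ^ t
          * inner ℂ (component 1 θ α β k) (component 1 θ α β l)
        + star (star (band θ k) * band θ l) ^ t
          * inner ℂ (component (-1) θ α β k) (component (-1) θ α β l)
        + ((star (band θ k) * star (band θ l)) ^ t
          * inner ℂ (component 1 θ α β k) (component (-1) θ α β l)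
        + (band θ k * band θ l) ^ t
          * inner ℂ (component (-1) θ α β k) (component 1 θ α β l)) := by
  simp only [amplitude, inner_add_left, inner_add_right, inner_smul_left, inner_smul_right,
    map_pow, mul_pow, star_mul', Complex.star_def, Complex.conj_conj]
  ring

theorem integral_inner_amplitude {θ : ℝ} (ha : |coupling θ| < 1 / 2) (α β : ℂ) (t : ℕ) (η : ℝ) :
    ∫ k in (-Real.pi)..Real.pi,
        inner ℂ (amplitude θ α β t k) (amplitude θ α β t (k - η))
      = 2 * Real.pi * ∑ x ∈ reach t, wave (-η) x * (‖walk θ α β t x‖ : ℂ) ^ 2 := by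
  have h : ∀ k, amplitude θ α β t k = ∑ x ∈ reach t, wave k x • walk θ α β t x := fun k =>
    (hasSum_wave_walk ha α β t k).unique (hasSum_sum_of_ne_finset_zero fun x hx => by
      rw [walk_eq_zero_of_notMem_reach θ α β hx, smul_zero])
  simp only [h]
  exact integral_inner_sum_wave (reach t) (walk θ α β t) η

/-! ### Asymptotics of the amplitudes. -/

theorem hasDerivAt_band {θ : ℝ} (ha : |coupling θ| < 1 / 2)
    (k : ℝ) : HasDerivAt (band θ) (speed θ k * I * band θ k) k := by
  have hC : HasDerivAt (fun k => Real.cos k + coupling θ * Real.sin k ^ 2)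
      (-(speed θ k * (Real.sin k * gapRoot θ k))) k := by
    refine ((Real.hasDerivAt_cos k).add
      (((Real.hasDerivAt_sin k).pow 2).const_mul (coupling θ))).congr_deriv ?_
    have hq := (gapRoot_pos ha k).ne'
    rw [speed, offset]
    field_simp
    push_cast
    ring
  have hS : HasDerivAt (fun k => Real.sin k * gapRoot θ k)
      (speed θ k * (Real.cos k + coupling θ * Real.sin k ^ 2)) k := by
    refine ((Real.hasDerivAt_sin k).mul (hasDerivAt_gapRoot ha k)).congr_deriv ?_
    have hq := (gapRoot_pos ha k).ne'
    have h2 := gapRoot_sq ha k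
    have h3 := Real.sin_sq k
    rw [speed]
    field_simp
    rw [h2, offset, h3]
    ring
  have h : HasDerivAt (band θ) _ k := hC.ofReal_comp.add (hS.ofReal_comp.mul_const I)
  refine h.congr_deriv ?_
  rw [band]
  push_cast
  linear_combination -(speed θ k * (Complex.sin k * gapRoot θ k)) * Complex.I_sq

theorem continuous_band {θ : ℝ} (ha : |coupling θ| < 1 / 2) : Continuous (band θ) :=
  continuous_iff_continuousAt.2 fun k => (hasDerivAt_band ha k).continuousAt

theorem star_band_mul_self {θ : ℝ} (ha : |coupling θ| < 1 / 2)
    (k : ℝ) : star (band θ k) * band θ k = 1 := by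
  have h2 := gapRoot_sq ha k
  have h3 := Real.sin_sq k
  have h : (Real.cos k + coupling θ * Real.sin k ^ 2) ^ 2 + (Real.sin k * gapRoot θ k) ^ 2 = 1 := by
    rw [mul_pow, h2, h3, offset]; ring
  rw [Complex.star_def, ← Complex.normSq_eq_conj_mul_self, band, Complex.normSq_add_mul_I, h,
    Complex.ofReal_one]

theorem norm_band {θ : ℝ} (ha : |coupling θ| < 1 / 2) (k : ℝ) : ‖band θ k‖ = 1 := by
  have h := congrArg norm (star_band_mul_self ha k)
  rw [norm_mul, norm_star, norm_one] at h
  nlinarith [norm_nonneg (band θ k)]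

theorem continuous_component {θ : ℝ} (ha : |coupling θ| < 1 / 2)
    (ε : ℂ) (α β : ℂ) : Continuous (component ε θ α β) := by
  have h1 := continuous_gapRoot ha
  have h2 := continuous_offset θ
  have h3 : Continuous fun k => 1 / gapRoot θ k :=
    continuous_const.div h1 fun k => (gapRoot_pos ha k).ne'
  have h : Continuous (axis θ) := by
    unfold axis
    refine (Complex.continuous_ofReal.comp h3).smul (continuous_matrix fun i j => ?_)
    fin_cases i <;> fin_cases j <;> simp <;> fun_prop
  have hp : Continuous (proj ε θ) := by unfold proj; fun_prop
  have : component ε θ α β = fun k => WithLp.toLp 2 ((proj ε θ k).mulVec ![α, β]) := by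
    ext1 k
    rw [component, coinOp, Matrix.toEuclideanCLM_toLp]
  rw [this]
  exact (PiLp.continuous_toLp 2 _).comp (hp.matrix_mulVec continuous_const)

theorem continuous_amplitude {θ : ℝ} (ha : |coupling θ| < 1 / 2)
    (α β : ℂ) (t : ℕ) : Continuous (amplitude θ α β t) := by
  have h1 := continuous_band ha
  have h2 := continuous_component ha 1 α β
  have h3 := continuous_component ha (-1) α β
  unfold amplitude
  fun_prop

theorem inner_component_of_ne {θ : ℝ} (ha : |coupling θ| < 1 / 2) (α β : ℂ) (k : ℝ) :
    inner ℂ (component 1 θ α β k) (component (-1) θ α β k) = 0 ∧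
      inner ℂ (component (-1) θ α β k) (component 1 θ α β k) = 0 := by
  constructor
  · rw [inner_component 1 (-1) (.inl rfl) (.inr rfl) ha]; norm_num
  · rw [inner_component (-1) 1 (.inr rfl) (.inl rfl) ha]; norm_num

theorem inner_amplitude_self {θ : ℝ} (ha : |coupling θ| < 1 / 2)
    {α β : ℂ} (hαβ : ‖α‖ ^ 2 + ‖β‖ ^ 2 = 1) (t : ℕ) (k : ℝ) :
    inner ℂ (amplitude θ α β t k) (amplitude θ α β t k) = 1 := by
  obtain ⟨h1, h2⟩ := inner_component_of_ne ha α β k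
  rw [inner_amplitude, h1, h2, star_band_mul_self ha, star_one, one_pow,
    inner_component_self 1 (.inl rfl) ha α β hαβ, inner_component_self (-1) (.inr rfl) ha α β hαβ]
  ring

theorem norm_amplitude {θ : ℝ} (ha : |coupling θ| < 1 / 2)
    {α β : ℂ} (hαβ : ‖α‖ ^ 2 + ‖β‖ ^ 2 = 1) (t : ℕ) (k : ℝ) :
    ‖amplitude θ α β t k‖ = 1 := by
  have h := inner_amplitude_self ha hαβ t k
  have h' : ‖amplitude θ α β t k‖ ^ 2 = 1 := by
    rw [← inner_self_eq_norm_sq (𝕜 := ℂ), h, RCLike.one_re]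
  nlinarith [norm_nonneg (amplitude θ α β t k)]

/-- The limit (1 + z_t/t)^t → exp z, where z_t is a difference quotient of the eigenvalue ratio in
the variable η = 1/t. -/
theorem tendsto_band_pow {θ : ℝ} (ha : |coupling θ| < 1 / 2) (k ξ : ℝ) :
    Tendsto (fun t : ℕ => (star (band θ k) * band θ (k - ξ / t)) ^ t) atTop
      (𝓝 (Complex.exp (-(ξ * speed θ k) * I))) := by
  have h1 := star_band_mul_self ha k
  have hd : HasDerivAt (fun η : ℝ => star (band θ k) * band θ (k - ξ * η))
      (-(ξ * speed θ k) * I) 0 := by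
    have hl : HasDerivAt (fun η : ℝ => k - ξ * η) (-ξ) 0 := by
      simpa using ((hasDerivAt_id (0 : ℝ)).const_mul ξ).const_sub k
    have hb := hasDerivAt_band ha (k - ξ * 0)
    have := (hb.scomp (0 : ℝ) hl).const_mul (star (band θ k))
    refine this.congr_deriv ?_
    rw [mul_zero, sub_zero, Complex.real_smul]
    push_cast
    linear_combination -(ξ * speed θ k * I) * h1
  have h2 : Tendsto (fun t : ℕ => (t : ℂ) * (star (band θ k) * band θ (k - ξ / t) - 1)) atTop
      (𝓝 (-(ξ * speed θ k) * I)) := by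
    have hs := hasDerivAt_iff_tendsto_slope.1 hd
    have ht : Tendsto (fun t : ℕ => ((t : ℝ))⁻¹) atTop (𝓝[≠] 0) := by
      refine tendsto_nhdsWithin_iff.2 ⟨tendsto_inv_atTop_nhds_zero_nat, ?_⟩
      -- At t = 0 the inverse is 0 by convention, hence the restriction to large t.
      filter_upwards [eventually_gt_atTop 0] with t ht
      exact inv_ne_zero (by exact_mod_cast ht.ne')
    refine (hs.comp ht).congr fun t => ?_
    simp only [Function.comp_apply, slope_def_module, sub_zero, inv_inv, mul_zero, h1,
      Complex.real_smul, Complex.ofReal_natCast, div_eq_mul_inv]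
  refine (Complex.tendsto_one_add_pow_exp_of_tendsto h2).congr fun t => ?_
  rw [add_sub_cancel]

theorem tendsto_inner_amplitude {θ : ℝ} (ha : |coupling θ| < 1 / 2) (α β : ℂ) (k ξ : ℝ) :
    Tendsto (fun t : ℕ => inner ℂ (amplitude θ α β t k) (amplitude θ α β t (k - ξ / t))) atTop
      (𝓝 (Complex.exp (-(ξ * speed θ k) * I)
          * inner ℂ (component 1 θ α β k) (component 1 θ α β k)
        + Complex.exp ((ξ * speed θ k) * I)
          * inner ℂ (component (-1) θ α β k) (component (-1) θ α β k))) := by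
  have hk : Tendsto (fun t : ℕ => k - ξ / t) atTop (𝓝 k) := by
    simpa using (tendsto_const_div_atTop_nhds_zero_nat ξ).const_sub k
  have hv : ∀ ε δ : ℂ, Tendsto
      (fun t : ℕ => inner ℂ (component ε θ α β k) (component δ θ α β (k - ξ / t))) atTop
      (𝓝 (inner ℂ (component ε θ α β k) (component δ θ α β k))) := fun ε δ =>
    tendsto_const_nhds.inner (((continuous_component ha δ α β).tendsto k).comp hk)
  -- The cross terms need no oscillation argument: the phase has modulus one, and the inner product
  -- tends to that of two orthogonal vectors as ξ/t → 0.
  have hcross : ∀ (z : ℕ → ℂ) (w : ℕ → ℂ), (∀ t, ‖z t‖ = 1) → Tendsto w atTop (𝓝 0) →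
      Tendsto (fun t => z t ^ t * w t) atTop (𝓝 0) := fun z w hz hw => by
    rw [tendsto_zero_iff_norm_tendsto_zero] at hw ⊢
    simpa [hz] using hw
  obtain ⟨o1, o2⟩ := inner_component_of_ne ha α β k
  have hp := tendsto_band_pow ha k ξ
  have hm : Tendsto (fun t : ℕ => star (star (band θ k) * band θ (k - ξ / t)) ^ t) atTop
      (𝓝 (Complex.exp ((ξ * speed θ k) * I))) := by
    have := hp.star
    simp only [star_pow] at this
    convert this using 2
    rw [Complex.star_def, ← Complex.exp_conj]
    simp
  have h1 := hv 1 (-1)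
  have h2 := hv (-1) 1
  rw [o1] at h1
  rw [o2] at h2
  have := ((hp.mul (hv 1 1)).add (hm.mul (hv (-1) (-1)))).add
    ((hcross (fun t => star (band θ k) * star (band θ (k - ξ / t))) _
      (fun t => by rw [norm_mul, norm_star, norm_star, norm_band ha, norm_band ha, mul_one]) h1).add
    (hcross (fun t => band θ k * band θ (k - ξ / t)) _
      (fun t => by rw [norm_mul, norm_band ha, norm_band ha, mul_one]) h2))
  rw [add_zero, add_zero] at this
  exact this.congr fun t => (inner_amplitude θ α β t k _).symm

theorem tendsto_integral_inner_amplitude {θ : ℝ} (ha : |coupling θ| < 1 / 2)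
    {α β : ℂ} (hαβ : ‖α‖ ^ 2 + ‖β‖ ^ 2 = 1) (ξ : ℝ) :
    Tendsto (fun t : ℕ => ∫ k in (-Real.pi)..Real.pi,
        inner ℂ (amplitude θ α β t k) (amplitude θ α β t (k - ξ / t))) atTop
      (𝓝 (∫ k in (-Real.pi)..Real.pi, (Complex.exp (-(ξ * speed θ k) * I)
          * inner ℂ (component 1 θ α β k) (component 1 θ α β k)
        + Complex.exp ((ξ * speed θ k) * I)
          * inner ℂ (component (-1) θ α β k) (component (-1) θ α β k)))) := by
  refine intervalIntegral.tendsto_integral_filter_of_dominated_convergence (fun _ => 1) ?_ ?_ ?_ ?_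
  · refine .of_forall fun t => Continuous.aestronglyMeasurable ?_
    have := continuous_amplitude ha α β t
    fun_prop
  · refine .of_forall fun t => .of_forall fun k _ => ?_
    refine (norm_inner_le_norm _ _).trans_eq ?_
    rw [norm_amplitude ha hαβ, norm_amplitude ha hαβ, mul_one]
  · exact intervalIntegrable_const
  · exact .of_forall fun k _ => tendsto_inner_amplitude ha α β k ξ

/-! ### Position law, limit law and their characteristic functions. -/

theorem offset_neg (θ k : ℝ) : offset θ (-k) = offset θ k := by
  rw [offset, offset, Real.cos_neg]

theorem gapRoot_neg (θ k : ℝ) : gapRoot θ (-k) = gapRoot θ k := by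
  rw [gapRoot, gapRoot, offset_neg]

theorem speed_neg (θ k : ℝ) : speed θ (-k) = speed θ k := by
  rw [speed, speed, offset_neg, gapRoot_neg]

theorem bias_neg (θ : ℝ) (α β : ℂ) (k : ℝ) : bias θ α β (-k) = bias θ α β k := by
  rw [bias, bias, offset_neg, gapRoot_neg]

theorem integral_symm_interval {g : ℝ → ℂ} (hg : Continuous g) (a : ℝ) :
    ∫ k in (-a)..a, g k = ∫ k in (0)..a, (g k + g (-k)) := by
  have h := intervalIntegral.integral_comp_neg (a := 0) (b := a) g
  rw [neg_zero] at h
  have hn : Continuous fun k => g (-k) := hg.comp continuous_neg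
  rw [intervalIntegral.integral_add (hg.intervalIntegrable _ _) (hn.intervalIntegrable _ _), h, add_comm,
    intervalIntegral.integral_add_adjacent_intervals (hg.intervalIntegrable _ _)
      (hg.intervalIntegrable _ _)]

theorem integral_positionLaw (θ : ℝ) (α β : ℂ) (t : ℕ) (G : ℤ → ℂ) :
    ∫ n, G n ∂positionLaw θ α β t
      = ∑ x ∈ reach t, G x * (‖walk θ α β t x‖ : ℂ) ^ 2 := by
  rw [positionLaw, integral_sum_dirac fun _ => ENNReal.ofReal_ne_top,
    tsum_eq_sum (s := reach t) fun x hx => by simp [walk_eq_zero_of_notMem_reach θ α β hx]]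
  refine Finset.sum_congr rfl fun x _ => ?_
  rw [ENNReal.toReal_ofReal (sq_nonneg _), Complex.real_smul, mul_comm, Complex.ofReal_pow]

/-- Parseval with zero shift: the amplitude is a unit vector for every k, so unitarity of U₁ and U₂
on the whole space is not required. -/
theorem sum_norm_walk_sq {θ : ℝ} (ha : |coupling θ| < 1 / 2) {α β : ℂ}
    (hαβ : ‖α‖ ^ 2 + ‖β‖ ^ 2 = 1) (t : ℕ) : ∑ x ∈ reach t, ‖walk θ α β t x‖ ^ 2 = 1 := by
  have h := integral_inner_amplitude ha α β t 0
  have hpi : (2 * Real.pi : ℂ) ≠ 0 := by exact_mod_cast Real.two_pi_pos.ne'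
  have hw : ∀ x, wave (-0) x = 1 := fun x => by simp [wave]
  simp only [sub_zero, inner_amplitude_self ha hαβ, intervalIntegral.integral_const, hw,
    one_mul, Complex.real_smul, mul_one] at h
  have h2 : (2 * Real.pi : ℂ) * ∑ x ∈ reach t, (‖walk θ α β t x‖ : ℂ) ^ 2
      = (2 * Real.pi) * 1 := by
    rw [← h]; push_cast; ring
  exact_mod_cast mul_left_cancel₀ hpi h2

theorem isProbabilityMeasure_positionLaw {θ : ℝ} (ha : |coupling θ| < 1 / 2) {α β : ℂ}
    (hαβ : ‖α‖ ^ 2 + ‖β‖ ^ 2 = 1) (t : ℕ) : IsProbabilityMeasure (positionLaw θ α β t) := by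
  constructor
  rw [positionLaw, Measure.sum_apply _ MeasurableSet.univ,
    tsum_eq_sum (s := reach t) fun x hx => by simp [walk_eq_zero_of_notMem_reach θ α β hx]]
  simp only [Measure.smul_apply, measure_univ, smul_eq_mul, mul_one]
  rw [← ENNReal.ofReal_sum_of_nonneg fun _ _ => sq_nonneg _, sum_norm_walk_sq ha hαβ,
    ENNReal.ofReal_one]

theorem charFun_map_positionLaw {θ : ℝ} (ha : |coupling θ| < 1 / 2) (α β : ℂ) (t : ℕ) (ξ : ℝ) :
    charFun ((positionLaw θ α β t).map fun n : ℤ => (n : ℝ) / t) ξ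
      = (1 / (2 * Real.pi) : ℂ) * ∫ k in (-Real.pi)..Real.pi,
          inner ℂ (amplitude θ α β t k) (amplitude θ α β t (k - ξ / t)) := by
  have hpi : (2 * Real.pi : ℂ) ≠ 0 := by exact_mod_cast Real.two_pi_pos.ne'
  rw [charFun_apply_real, integral_map (by fun_prop)
    (Continuous.aestronglyMeasurable (by fun_prop)), integral_positionLaw,
    integral_inner_amplitude ha, ← mul_assoc, one_div_mul_cancel hpi, one_mul]
  refine Finset.sum_congr rfl fun x _ => ?_
  rw [wave]
  congr 2
  push_cast
  ring

theorem limitLaw_apply {θ : ℝ} (hθ : θ ∈ Set.Ioo 0 Real.pi) (hc : 2 * Real.cos θ ^ 2 - 1 ≠ 0)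
    (h0 : coupling θ ≠ 0) {α β : ℂ} (hαβ : ‖α‖ ^ 2 + ‖β‖ ^ 2 = 1)
    {s : Set ℝ} (hs : MeasurableSet s) :
    limitLaw θ α β s = ENNReal.ofReal (∫ x in s, density θ α β x) := by
  rw [limitLaw, withDensity_apply _ hs, ofReal_integral_eq_lintegral_ofReal
    (integrable_density hθ hc h0 α β).integrableOn
    (.of_forall fun x => density_nonneg hθ hc h0 hαβ x)]

theorem isProbabilityMeasure_limitLaw {θ : ℝ} (hθ : θ ∈ Set.Ioo 0 Real.pi)
    (hc : 2 * Real.cos θ ^ 2 - 1 ≠ 0) (h0 : coupling θ ≠ 0) {α β : ℂ}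
    (hαβ : ‖α‖ ^ 2 + ‖β‖ ^ 2 = 1) : IsProbabilityMeasure (limitLaw θ α β) := by
  constructor
  rw [limitLaw_apply hθ hc h0 hαβ MeasurableSet.univ, Measure.restrict_univ,
    integral_density hθ hc h0, ENNReal.ofReal_one]

theorem charFun_limitLaw {θ : ℝ} (hθ : θ ∈ Set.Ioo 0 Real.pi) (hc : 2 * Real.cos θ ^ 2 - 1 ≠ 0)
    (h0 : coupling θ ≠ 0) {α β : ℂ} (hαβ : ‖α‖ ^ 2 + ‖β‖ ^ 2 = 1) (ξ : ℝ) :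
    charFun (limitLaw θ α β) ξ
      = (1 / (2 * Real.pi) : ℂ) * ∫ k in (-Real.pi)..Real.pi, (Complex.exp (-(ξ * speed θ k) * I)
          * inner ℂ (component 1 θ α β k) (component 1 θ α β k)
        + Complex.exp ((ξ * speed θ k) * I)
          * inner ℂ (component (-1) θ α β k) (component (-1) θ α β k)) := by
  have ha := abs_coupling_lt hc
  have c1 := continuous_speed ha
  have c2 := continuous_component ha 1 α β
  have c3 := continuous_component ha (-1) α β
  rw [charFun_apply_real, limitLaw, integral_withDensity_eq_integral_toReal_smul
    (measurable_density θ α β).ennreal_ofReal (by simp)]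
  simp only [ENNReal.toReal_ofReal (density_nonneg hθ hc h0 hαβ _), Complex.real_smul]
  rw [integral_density_mul hθ hc h0 α β (G := fun x : ℝ => Complex.exp (ξ * x * I))
    (by fun_prop), integral_symm_interval (by fun_prop), intervalIntegral.integral_const_mul]
  -- On the folded interval the contributions of k and -k add up: the odd parts of the weights
  -- cancel and the even parts double.
  congr 2
  ext1 k
  simp only [inner_component_self 1 (.inl rfl) ha α β hαβ,
    inner_component_self (-1) (.inr rfl) ha α β hαβ, speed_neg, bias_neg, gapRoot_neg,
    Real.sin_neg]
  push_cast
  rw [mul_neg (ξ : ℂ)]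
  ring

theorem tendsto_charFun {θ : ℝ} (hθ : θ ∈ Set.Ioo 0 Real.pi) (hc : 2 * Real.cos θ ^ 2 - 1 ≠ 0)
    (h0 : coupling θ ≠ 0) {α β : ℂ} (hαβ : ‖α‖ ^ 2 + ‖β‖ ^ 2 = 1) (ξ : ℝ) :
    Tendsto (fun t : ℕ => charFun ((positionLaw θ α β t).map fun n : ℤ => (n : ℝ) / t) ξ) atTop
      (𝓝 (charFun (limitLaw θ α β) ξ)) := by
  have ha := abs_coupling_lt hc
  rw [charFun_limitLaw hθ hc h0 hαβ]
  simp only [charFun_map_positionLaw ha]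
  exact (tendsto_integral_inner_amplitude ha hαβ ξ).const_mul _

/-! ### Weak convergence and the gap. -/

theorem tendstoInDistribution_positionLaw {θ : ℝ} (hθ : θ ∈ Set.Ioo 0 Real.pi)
    (hc : 2 * Real.cos θ ^ 2 - 1 ≠ 0) (h0 : coupling θ ≠ 0) {α β : ℂ}
    (hαβ : ‖α‖ ^ 2 + ‖β‖ ^ 2 = 1)
    [∀ t, IsProbabilityMeasure (positionLaw θ α β t)] [IsProbabilityMeasure (limitLaw θ α β)] :
    TendstoInDistribution (fun (t : ℕ) (n : ℤ) => (n : ℝ) / t) atTop (fun x : ℝ => x)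
      (positionLaw θ α β) (limitLaw θ α β) where
  forall_aemeasurable t := by fun_prop
  aemeasurable_limit := aemeasurable_id
  tendsto := by
    refine ProbabilityMeasure.tendsto_iff_tendsto_charFun.2 fun ξ => ?_
    simpa using tendsto_charFun hθ hc h0 hαβ ξ

/-- Convergence of the probabilities of sets with a negligible boundary. -/
theorem tendsto_positionLaw_real {θ : ℝ} (hθ : θ ∈ Set.Ioo 0 Real.pi)
    (hc : 2 * Real.cos θ ^ 2 - 1 ≠ 0) (h0 : coupling θ ≠ 0) {α β : ℂ}
    (hαβ : ‖α‖ ^ 2 + ‖β‖ ^ 2 = 1) {s : Set ℝ} (hs : MeasurableSet s)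
    (hfr : volume (frontier s) = 0) :
    Tendsto (fun t : ℕ => (positionLaw θ α β t).real {n : ℤ | (n : ℝ) / t ∈ s}) atTop
      (𝓝 (∫ x in s, density θ α β x)) := by
  have hp := isProbabilityMeasure_positionLaw (abs_coupling_lt hc) hαβ
  have hl := isProbabilityMeasure_limitLaw hθ hc h0 hαβ
  have h := (tendstoInDistribution_positionLaw hθ hc h0 hαβ).tendsto
  -- The limit law is absolutely continuous, so a Lebesgue-null frontier suffices for the
  -- portmanteau theorem.
  have hfr' : limitLaw θ α β (frontier s) = 0 :=
    withDensity_absolutelyContinuous volume _ hfr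
  have h1 := ProbabilityMeasure.tendsto_measure_of_null_frontier_of_tendsto' h (E := s)
    (by simpa using hfr')
  simp only [ProbabilityMeasure.coe_mk, Measure.map_id'] at h1
  have h2 := (ENNReal.tendsto_toReal (measure_ne_top (limitLaw θ α β) s)).comp h1
  rw [limitLaw_apply hθ hc h0 hαβ hs, ENNReal.toReal_ofReal
    (integral_nonneg fun x => density_nonneg hθ hc h0 hαβ x)] at h2
  refine h2.congr fun t => ?_
  rw [Function.comp_apply, Measure.map_apply (by fun_prop) hs]
  rfl

theorem innerEdge_pos {θ : ℝ} (hθ : θ ∈ Set.Ioo 0 Real.pi) (hc : 2 * Real.cos θ ^ 2 - 1 ≠ 0) :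
    0 < innerEdge θ := by
  rw [innerEdge, cs_eq hθ]
  exact Real.sqrt_pos.2 (by linarith [abs_coupling_lt hc])

theorem density_eq_zero_of_abs_le {θ : ℝ} {α β : ℂ} {x : ℝ} (hx : |x| ≤ innerEdge θ) :
    density θ α β x = 0 := by
  by_contra h
  rw [abs_le] at hx
  rcases support_density_subset θ α β h with h' | h'
  · linarith [h'.2, hx.1]
  · linarith [h'.1, hx.2]

end GapWalk

end

theorem theorem2 (θ : ℝ) (hθ : θ ∈ Set.Ioo 0 Real.pi) (hθ₁ : θ ≠ Real.pi / 4)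
    (hθ₂ : θ ≠ Real.pi / 2) (hθ₃ : θ ≠ 3 * Real.pi / 4)
    (α β : ℂ) (hαβ : ‖α‖ ^ 2 + ‖β‖ ^ 2 = 1) :
    -- the density is a probability density, supported on the two intervals
    (∀ x, 0 ≤ GapWalk.density θ α β x) ∧
    Integrable (GapWalk.density θ α β) ∧
    ∫ x, GapWalk.density θ α β x = 1 ∧
    Function.support (GapWalk.density θ α β) ⊆
      Set.Ioo (-GapWalk.outerEdge θ) (-GapWalk.innerEdge θ) ∪
        Set.Ioo (GapWalk.innerEdge θ) (GapWalk.outerEdge θ) ∧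
    -- convergence of the distribution functions of `X_t / t`
    (∀ x : ℝ, Tendsto
      (fun t : ℕ => (GapWalk.positionLaw θ α β t).real {n : ℤ | (n : ℝ) / t ≤ x}) atTop
      (𝓝 (∫ y in Set.Iic x, GapWalk.density θ α β y))) ∧
    -- weak convergence of `X_t / t` to the limit law
    (∃ (_ : ∀ t, IsProbabilityMeasure (GapWalk.positionLaw θ α β t))
      (_ : IsProbabilityMeasure (GapWalk.limitLaw θ α β)),
      TendstoInDistribution (fun (t : ℕ) (n : ℤ) => (n : ℝ) / t) atTop (fun x : ℝ => x)
        (GapWalk.positionLaw θ α β) (GapWalk.limitLaw θ α β)) ∧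
    -- the gap around the origin
    0 < GapWalk.innerEdge θ ∧
    Tendsto (fun t : ℕ => (GapWalk.positionLaw θ α β t).real
      {n : ℤ | |(n : ℝ) / t| ≤ GapWalk.innerEdge θ}) atTop (𝓝 0) := by

  have hc := GapWalk.two_mul_cos_sq_sub_one_ne_zero hθ hθ₁ hθ₃
  have h0 := GapWalk.coupling_ne_zero hθ hθ₂
  have hp := GapWalk.isProbabilityMeasure_positionLaw (GapWalk.abs_coupling_lt hc) hαβ
  have hl := GapWalk.isProbabilityMeasure_limitLaw hθ hc h0 hαβ
  refine ⟨GapWalk.density_nonneg hθ hc h0 hαβ, GapWalk.integrable_density hθ hc h0 α β,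
    GapWalk.integral_density hθ hc h0 α β, GapWalk.support_density_subset θ α β, fun x => ?_,
    ⟨hp, hl, GapWalk.tendstoInDistribution_positionLaw hθ hc h0 hαβ⟩,
    GapWalk.innerEdge_pos hθ hc, ?_⟩
  · exact GapWalk.tendsto_positionLaw_real hθ hc h0 hαβ (s := Set.Iic x) measurableSet_Iic
      (by simp)
  · have hpos := GapWalk.innerEdge_pos hθ hc
    have h := GapWalk.tendsto_positionLaw_real hθ hc h0 hαβ
      (s := Set.Icc (-GapWalk.innerEdge θ) (GapWalk.innerEdge θ)) measurableSet_Icc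
      (by rw [frontier_Icc (by linarith)]; exact (Set.toFinite _).measure_zero _)
    have hz : ∫ x in Set.Icc (-GapWalk.innerEdge θ) (GapWalk.innerEdge θ),
        GapWalk.density θ α β x = 0 :=
      setIntegral_eq_zero_of_forall_eq_zero fun x hx =>
        GapWalk.density_eq_zero_of_abs_le (abs_le.2 hx)
    rw [hz] at h
    simpa only [Set.mem_Icc, ← abs_le] using h
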